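/- **Setting.** Binary strings are identified with natural numbers by $\epsilon\mapsto 0,\ 0\mapsto 1,\ 1\mapsto 2,\ 00\mapsto 3,\dots$; $l(p)$ is the length of $p$, and $\log$ of a positive number is $\lceil\log_2\cdot\rceil$ (with $\log 0=0$ in the term $2\log k_x$). Let $\Phi$ be an optimal prefix-free interpreter, with computable step function $\Phi_t(p|y)$ (the result of running program $p$ on the tuple of numbers $y$ for $t$ steps; halting is permanent, and a program halting within $t$ steps has at most $t$ bits) and limit $\Phi(p|y)$. Prefix-free means that for each $y$ the set of programs halting on $y$ is prefix-free; optimal means that every prefix-free interpreter is simulated by $\Phi$ with $O(1)$ additional program bits. For $x\in\{0,1\}^n$ all computations also get $n$ as an input: $K_t(x)=\min\{l(p):\Phi_t(p|n)=x\}$ and $K(x)=\min\{l(p):\Phi(p|n)=x\}$. Put $$\Omega^n_t=\sum\{2^{-l(p)}:\Phi_t(p|n)\in\{0,1\}^n\},\quad \Omega^n=\lim_t\Omega^n_t,\quad t_k=\min\{t:\Omega^n-\Omega^n_t\le 2^{-k}\},$$ let $\Omega^{n,j}$ be the string of the first $j$ bits of the binary expansion of $\Omega^n$, and, for a constant $d$,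 let the m-depth of $x$ be $k_x=\min\{k:K_{t_k}(x)\le K(x)+d\}$. **Statistics.** Models $Z$ of $x\in\{0,1\}^n$ are of one of three kinds, with complexity $K(Z)$ the length of a shortest program of the indicated sort: * (S) a finite set $S\ni x$ of binary strings; a program for $S$ enumerates, given $n$, all elements of $S$ and halts; $\|\log S\|=\log|S|$. * (P) a computable semimeasure $P\ge 0$ (that is, $\sum_{y\in\{0,1\}^m}P(y)\le1$ for every $m$) with $P(x)>0$; a program for $P$ computes, given $n$, a string $y$ and a precision $m$, a rational number within $2^{-m}$ of $P(y)$; $\|\log P\|=-\log P(x)$, here rounded up to an integer. * (F) a computable partial function $F$ from binary strings to binary strings with prefix-free domain; a program for $F$ halts, given $n$, on every $d$, decides whether $F(d)$ is defined and outputs $F(d)$ if it is; $\|\log F\|$ is $l(d)$ for some $d\in F^{-1}(x)$. $Z$ is a sufficient statistic of $x$ (with constant $c$) if $|K(Z)+\|\log Z\|-K(x)|\le c$, and a minimal one (with constant $c'$) if moreover $K(Z)\le K(Z')+c'$ for all sufficient statistics $Z'$ of $x$ of the same kind (with the same constant $c$). **Proposition 4.3.** For all constants $c,c'$ and every sufficiently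 large (depending on $\Phi, c,c'$) constant $d$ in the definition of the m-depth there is a constant $C$ such that for every binary string $x$, with $n=l(x)$, every minimal sufficient set statistic $S_x$ of $x$ satisfies: 1. for every shortest program $S_x^*$ for $S_x$ there is a program $p$ with $l(p)\le C$ and $\Phi(p\,|\,S_x^*,k_x,n)=\Omega^{n,k_x}$; 2. $l^S_x:=K(S_x)\ \ge\ k_x-2\log k_x-C$. The same two statements hold for every minimal sufficient probabilistic statistic $P_x$ and for every minimal sufficient function statistic $F_x$ of $x$, with $K(P_x)$ and $K(F_x)$ in place of $K(S_x)$. -/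

import Mathlib

/-- The natural association `ε ↦ 0, 0 ↦ 1, 1 ↦ 2, 00 ↦ 3, 01 ↦ 4, …` of binary strings with
natural numbers. -/
def strCode (x : List Bool) : ℕ := x.foldl (fun a b => 2 * a + 1 + b.toNat) 0

/-- A set of binary strings is prefix-free if no element is a proper prefix of another one. -/
def IsPrefixFreeSet (D : Set (List Bool)) : Prop :=
  ∀ p ∈ D, ∀ q ∈ D, p <+: q → p = q

/-- The length of a shortest element of a set of programs (`⊤` if the set is empty). -/
noncomputable def minLength (D : Set (List Bool)) : ℕ∞ := ⨅ p ∈ D, (p.length : ℕ∞)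

/-- `q` is a shortest element of a set of programs. -/
def IsShortest (q : List Bool) (D : Set (List Bool)) : Prop :=
  q ∈ D ∧ ∀ p ∈ D, q.length ≤ p.length

/-- An interpreter, given by its computable step function: `step t p y` is the result `Φ_t(p|y)`
of running the program `p` on the input tuple `y` for `t` steps, and `none` if the computation
has not halted by then. -/
structure Interpreter where
  step : ℕ → List Bool → List ℕ → Option (List ℕ)
  computable_step : Computable fun a : ℕ × List Bool × List ℕ => step a.1 a.2.1 a.2.2
  /-- Once the computation has halted, its output does not change any more. -/
  mono_step : ∀ s t p y z, s ≤ t → step s p y = some z → step t p y = some z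
  /-- A computation that halts within `t` steps has read at most `t` program bits. -/
  length_le_of_step : ∀ t p y z, step t p y = some z → p.length ≤ t

namespace Interpreter

/-- `Φ(p|y) = z`, where `Φ(p|y)` is the limit of `Φ_t(p|y)`. -/
def Outputs (Φ : Interpreter) (p : List Bool) (y z : List ℕ) : Prop :=
  ∃ t, Φ.step t p y = some z

/-- For every input `y` the set of programs that halt on `y` is prefix-free. -/
def PrefixFree (Φ : Interpreter) : Prop :=
  ∀ y, IsPrefixFreeSet {p | ∃ z, Φ.Outputs p y z}

/-- Optimality: `Φ` simulates every prefix-free interpreter with at most a constant number of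
additional program bits. -/
def Optimal (Φ : Interpreter) : Prop :=
  ∀ Ψ : Interpreter, Ψ.PrefixFree → ∃ c : ℕ, ∀ p y z, Ψ.Outputs p y z →
    ∃ q, q.length ≤ p.length + c ∧ Φ.Outputs q y z

/-- The time-bounded length-conditional complexity `K_t(x)`: the parameter `n` is always
available as an input, and the string `x` is output as a number. -/
noncomputable def stageK (Φ : Interpreter) (n t : ℕ) (x : List Bool) : ℕ∞ :=
  minLength {p | Φ.step t p [n] = some [strCode x]}

/-- The length-conditional prefix complexity `K(x)`. -/
noncomputable def K (Φ : Interpreter) (n : ℕ) (x : List Bool) : ℕ∞ :=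
  minLength {p | Φ.Outputs p [n] [strCode x]}

/-- `u ⟶ v` with constant `C`: some program of at most `C` bits computes `v` from `u` and `n`. -/
def ComputesWithin (Φ : Interpreter) (n C : ℕ) (u v : List ℕ) : Prop :=
  ∃ p : List Bool, p.length ≤ C ∧ Φ.Outputs p (u ++ [n]) v

/-! ### The numbers `Ω^n` and the m-depth -/

open Classical in
/-- `Ω^n_t`: the sum of `2^{-l(p)}` over the programs `p` whose output after `t` steps (given `n`)
is a string of length `n`. Only programs of length at most `t` contribute. -/
noncomputable def stageOmega (Φ : Interpreter) (n t : ℕ) : ℝ :=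
  ∑' p : List Bool,
    if ∃ x : List Bool, x.length = n ∧ Φ.step t p [n] = some [strCode x]
    then ((1 : ℝ) / 2) ^ p.length else 0

/-- `Ω^n = lim_t Ω^n_t` (for a prefix-free interpreter the sequence is nondecreasing and bounded
by `1`). -/
noncomputable def Omega (Φ : Interpreter) (n : ℕ) : ℝ :=
  Filter.limUnder Filter.atTop fun t => Φ.stageOmega n t

/-- `Ω^{n,j}`: the first `j` bits after the binary point of `Ω^n`. -/
noncomputable def omegaBits (Φ : Interpreter) (n j : ℕ) : List Bool :=
  List.ofFn fun i : Fin j => decide (⌊(2 : ℝ) ^ (i.val + 1) * Φ.Omega n⌋₊ % 2 = 1)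

/-- `t_k`: the least time with `Ω^n - Ω^n_t ≤ 2^{-k}`. -/
noncomputable def omegaTime (Φ : Interpreter) (n k : ℕ) : ℕ :=
  sInf {t | Φ.Omega n - Φ.stageOmega n t ≤ ((1 : ℝ) / 2) ^ k}

/-- The m-depth `k_x` of `x`, where `d` is the constant up to which `K_{t_k}(x)` and `K(x)` have
to be equal (the inequality `K(x) ≤ K_t(x)` is automatic). -/
noncomputable def mDepth (Φ : Interpreter) (d : ℕ) (x : List Bool) : ℕ :=
  sInf {k | Φ.stageK x.length (Φ.omegaTime x.length k) x ≤ Φ.K x.length x + d}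

/-! ### Set statistics -/

/-- The programs that, given `n`, enumerate all elements of the finite set `S` and halt. -/
def setPrograms (Φ : Interpreter) (n : ℕ) (S : Finset (List Bool)) : Set (List Bool) :=
  {p | ∃ w : List ℕ, Φ.Outputs p [n] w ∧ ∀ a, a ∈ w ↔ ∃ y ∈ S, strCode y = a}

/-- `K(S)`. -/
noncomputable def setK (Φ : Interpreter) (n : ℕ) (S : Finset (List Bool)) : ℕ∞ :=
  minLength (Φ.setPrograms n S)

/-- `S` is a sufficient set statistic of `x`: `x ∈ S` and `K(S) + log |S| = K(x)` up to `c`. -/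
def IsSetStat (Φ : Interpreter) (c : ℕ) (x : List Bool) (S : Finset (List Bool)) : Prop :=
  x ∈ S ∧ Φ.setK x.length S + Nat.clog 2 S.card ≤ Φ.K x.length x + c ∧
    Φ.K x.length x ≤ Φ.setK x.length S + Nat.clog 2 S.card + c

/-- `S` is a sufficient set statistic whose complexity is minimal up to `c'`. -/
def IsMinSetStat (Φ : Interpreter) (c c' : ℕ) (x : List Bool) (S : Finset (List Bool)) : Prop :=
  Φ.IsSetStat c x S ∧ ∀ S', Φ.IsSetStat c x S' → Φ.setK x.length S ≤ Φ.setK x.length S' + c'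

/-! ### Probabilistic statistics -/

end Interpreter

/-- Length-conditional semimeasures: nonnegative functions on binary strings whose sum over the
strings of each length is at most `1`. -/
def IsSemimeasure (P : List Bool → ℝ) : Prop :=
  (∀ y, 0 ≤ P y) ∧ ∀ n : ℕ, ∑ y : Fin n → Bool, P (List.ofFn y) ≤ 1

namespace Interpreter

/-- The programs that, given `n`, compute the real-valued function `P`: on input `y` and a
precision `m` they output numerator and (shifted) denominator of a rational number that is
`2^{-m}`-close to `P y`. -/
def measurePrograms (Φ : Interpreter) (n : ℕ) (P : List Bool → ℝ) : Set (List Bool) :=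
  {p | ∀ y m, ∃ a b : ℕ, Φ.Outputs p [strCode y, m, n] [a, b] ∧
    |(a : ℝ) / ((b : ℝ) + 1) - P y| ≤ ((1 : ℝ) / 2) ^ m}

/-- `K(P)`, which is finite exactly if `P` is computable. -/
noncomputable def measureK (Φ : Interpreter) (n : ℕ) (P : List Bool → ℝ) : ℕ∞ :=
  minLength (Φ.measurePrograms n P)

/-- `P` is a sufficient probabilistic statistic of `x`: a computable semimeasure with
`K(P) - log P(x) = K(x)` up to `c`. -/
def IsProbStat (Φ : Interpreter) (c : ℕ) (x : List Bool) (P : List Bool → ℝ) : Prop :=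
  IsSemimeasure P ∧ (Φ.measurePrograms x.length P).Nonempty ∧ 0 < P x ∧
    Φ.measureK x.length P + ⌈-Real.logb 2 (P x)⌉₊ ≤ Φ.K x.length x + c ∧
    Φ.K x.length x ≤ Φ.measureK x.length P + ⌈-Real.logb 2 (P x)⌉₊ + c

/-- `P` is a sufficient probabilistic statistic whose complexity is minimal up to `c'`. -/
def IsMinProbStat (Φ : Interpreter) (c c' : ℕ) (x : List Bool) (P : List Bool → ℝ) : Prop :=
  Φ.IsProbStat c x P ∧
    ∀ P', Φ.IsProbStat c x P' → Φ.measureK x.length P ≤ Φ.measureK x.length P' + c'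

/-! ### Functional statistics -/

/-- The programs that, given `n`, compute the function `F`, where `F d = none` means that `F` is
undefined at `d`: they halt on every `d`, decide whether `F` is defined there, and if so output
its value. -/
def funPrograms (Φ : Interpreter) (n : ℕ) (F : List Bool → Option (List Bool)) :
    Set (List Bool) :=
  {p | ∀ d, Φ.Outputs p [strCode d, n] ((F d).elim [] fun y => [strCode y])}

/-- `K(F)`, which is finite exactly if `F` is computable. -/
noncomputable def funK (Φ : Interpreter) (n : ℕ) (F : List Bool → Option (List Bool)) : ℕ∞ :=
  minLength (Φ.funPrograms n F)

/-- `F` is a sufficient function statistic of `x`: a computable function with prefix-free domain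
such that `K(F) + l(d) = K(x)` up to `c` for some `d` with `F(d) = x`. -/
def IsFunStat (Φ : Interpreter) (c : ℕ) (x : List Bool) (F : List Bool → Option (List Bool)) :
    Prop :=
  IsPrefixFreeSet {d | (F d).isSome} ∧ (Φ.funPrograms x.length F).Nonempty ∧
    ∃ d, F d = some x ∧ Φ.funK x.length F + d.length ≤ Φ.K x.length x + c ∧
      Φ.K x.length x ≤ Φ.funK x.length F + d.length + c

/-- `F` is a sufficient function statistic whose complexity is minimal up to `c'`. -/
def IsMinFunStat (Φ : Interpreter) (c c' : ℕ) (x : List Bool)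
    (F : List Bool → Option (List Bool)) : Prop :=
  Φ.IsFunStat c x F ∧
    ∀ F', Φ.IsFunStat c x F' → Φ.funK x.length F ≤ Φ.funK x.length F' + c'

end Interpreter

/-! A model together with a codeword for `x` is a two-part description of `x`. Let `q` be a program
for the model. A set or a semimeasure yields a prefix-free table of codewords for its strings by
arithmetic coding; a function is such a table already, its arguments being the codewords. Feeding
`q` followed by a codeword `w` to a suitable prefix-free machine shows that every string in the
table has a program of length at most `|q| + |w| + c` (`exists_two_part`).

These programs can be waited for. Given `q` and `n`, run `Φ` until every string in the table has
been produced by such a short program (`IsCovered`). This covering time `t` is computable from `q`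
and `n`, without knowing `x`. If the description of `x` is optimal up to a constant `e`, which is
what sufficiency provides, then `K_t(x) ≤ K(x) + e + c`. Hence for `d ≥ e + c` and `k = k_x > 0` the
definition of the m-depth forces `t > t_{k-1}`. Both claims exploit that `t` is this late.

Claim 1: `Ω^n_t` lies within `2^{-(k-1)}` below `Ω^n`, so the integer parts of `2^k Ω^n_t` and `2^k
Ω^n` differ by 0, 1 or 2. Two extra bits name the difference, and `Ω^{n,k}` follows from `q`, `k`
and `n` (`exists_computesWithin_omegaBits`).

Claim 2: from `q` and `n` one can compute a string of length `n` that no program shorter than `n`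
has produced by time `t`. This gives a program `p` for it with `|p| ≤ |q| + C`. If `|p| < k - 1`,
then `p` has halted by time `t_{k-1} ≤ t`, since otherwise its weight would still be missing from
`Ω^n_t`; freshness then excludes `|p| < n`. So `min(n, k-1) ≤ |q| + C` (`exists_min_le_length`). As
`k ≤ K(x) + 1 ≤ n + O(1)`, this yields `k ≤ |q| + O(1)`, even without the logarithmic term.

`ModelKind` isolates what the argument needs from sets, semimeasures and functions;
`exists_depth_bounds` is the common conclusion. -/

/-! ### Computable operations on lists -/

section ListComputability

variable {α β σ : Type*} [Primcodable α] [Primcodable β] [Primcodable σ]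

/-- Recursion on an index `i` that reads the `i`-th entry: after `i` rounds the state is the fold
over the first `i` entries. The version for merely computable functions is needed because the step
function of an interpreter need not be primitive recursive. -/
theorem Computable.list_foldl {f : α → List β} {g : α → σ} {h : α → σ × β → σ}
    (hf : Computable f) (hg : Computable g) (hh : Computable₂ h) :
    Computable fun a => (f a).foldl (fun s b => h a (s, b)) (g a) := by
  have key : Computable fun a => Nat.rec (motive := fun _ => σ) (g a)
      (fun i s => Option.casesOn (motive := fun _ => σ) ((f a)[i]?) s fun b => h a (s, b))
      (f a).length := by
    refine Computable.nat_rec (h := fun a p => Option.casesOn (motive := fun _ => σ) ((f a)[p.1]?)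
      p.2 fun b => h a (p.2, b)) (Computable.list_length.comp hf) hg ?_
    refine Computable.option_casesOn
      (Computable.list_getElem?.comp (hf.comp Computable.fst)
        (Computable.fst.comp Computable.snd)) (Computable.snd.comp Computable.snd) ?_
    exact hh.comp (Computable.fst.comp Computable.fst)
      ((Computable.snd.comp (Computable.snd.comp Computable.fst)).pair Computable.snd)
  refine key.of_eq fun a => ?_
  have aux : ∀ i ≤ (f a).length, Nat.rec (motive := fun _ => σ) (g a)
      (fun i s => Option.casesOn (motive := fun _ => σ) ((f a)[i]?) s fun b => h a (s, b)) i =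
      ((f a).take i).foldl (fun s b => h a (s, b)) (g a) := by
    intro i hi
    induction i with
    | zero => simp
    | succ i ih =>
      have hlt : i < (f a).length := hi
      simp only [ih hlt.le, List.getElem?_eq_getElem hlt, List.take_succ_eq_append_getElem hlt,
        List.foldl_append, List.foldl_cons, List.foldl_nil]
  simpa using aux _ le_rfl

theorem Computable.list_filterMap {f : α → List β} {g : α → β → Option σ}
    (hf : Computable f) (hg : Computable₂ g) :
    Computable fun a => (f a).filterMap (g a) := by
  have key : Computable fun a => (f a).foldl (fun s b => s ++ (g a b).toList) [] := by
    refine Computable.list_foldl (h := fun a s => s.1 ++ (g a s.2).toList) hf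
      (Computable.const []) ?_
    exact Computable.list_append.comp (Computable.fst.comp Computable.snd)
      (Primrec.optionToList.to_comp.comp (hg.comp Computable.fst
        (Computable.snd.comp Computable.snd)))
  refine key.of_eq fun a => ?_
  have aux : ∀ (l : List β) (s : List σ),
      l.foldl (fun s b => s ++ (g a b).toList) s = s ++ l.filterMap (g a) := by
    intro l
    induction l with
    | nil => simp
    | cons b l ih => intro s; cases hb : g a b <;> simp [ih, hb]
  simpa using aux (f a) []

theorem Computable.ite {c : α → Prop} [DecidablePred c] {f g : α → σ}
    (hc : Computable fun a => decide (c a)) (hf : Computable f) (hg : Computable g) :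
    Computable fun a => if c a then f a else g a :=
  (Computable.cond hc hf hg).of_eq fun a => by by_cases h : c a <;> simp [h]

theorem Computable.decide_nat_eq {f g : α → ℕ} (hf : Computable f) (hg : Computable g) :
    Computable fun a => decide (f a = g a) := by
  have h : Computable fun b : ℕ × ℕ => decide (b.1 = b.2) :=
    (PrimrecPred.decide (Primrec.eq.comp Primrec.fst Primrec.snd)).to_comp
  exact h.comp (hf.pair hg)

theorem Primrec.nat_pow {f g : α → ℕ} (hf : Primrec f) (hg : Primrec g) :
    Primrec fun a => f a ^ g a := by
  have : Primrec₂ fun a b : ℕ => a ^ b := Primrec₂.unpaired'.1 Nat.Primrec.pow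
  exact this.comp hf hg

end ListComputability

/-! ### Strings -/

/-- The list of all binary strings of length `n`. -/
def allStrs : ℕ → List (List Bool)
  | 0 => [[]]
  | n + 1 => (allStrs n).flatMap fun s => [false :: s, true :: s]

theorem mem_allStrs {n : ℕ} {s : List Bool} : s ∈ allStrs n ↔ s.length = n := by
  induction n generalizing s with
  | zero => simp [allStrs]
  | succ n ih =>
    simp only [allStrs, List.mem_flatMap, List.mem_cons, List.not_mem_nil, or_false]
    constructor
    · rintro ⟨u, hu, rfl | rfl⟩ <;> simp [ih.1 hu]
    · intro h
      cases s with
      | nil => simp at h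
      | cons b s =>
        refine ⟨s, ih.2 (by simpa using h), ?_⟩
        cases b <;> simp

theorem length_allStrs (n : ℕ) : (allStrs n).length = 2 ^ n := by
  induction n with
  | zero => rfl
  | succ n ih => simp [allStrs, List.length_flatMap, ih, pow_succ]

theorem nodup_allStrs (n : ℕ) : (allStrs n).Nodup := by
  induction n with
  | zero => simp [allStrs]
  | succ n ih =>
    rw [allStrs, List.nodup_flatMap]
    refine ⟨fun s _ => by simp, ih.imp ?_⟩
    intro a b hab
    simp [Function.onFun, hab.symm]

theorem primrec_allStrs : Primrec allStrs := by
  have : Primrec fun n : ℕ => Nat.rec (motive := fun _ => List (List Bool)) [[]]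
      (fun _ l => l.flatMap fun s => [false :: s, true :: s]) n := by
    refine Primrec.nat_rec₁ _ ?_
    refine Primrec.list_flatMap Primrec.snd ?_
    exact Primrec.list_cons.comp (Primrec.list_cons.comp (Primrec.const _) Primrec.snd)
      (Primrec.list_cons.comp (Primrec.list_cons.comp (Primrec.const _) Primrec.snd)
        (Primrec.const _))
  refine this.of_eq fun n => ?_
  induction n with
  | zero => rfl
  | succ n ih => simp only [allStrs, ih]

/-- The list of all binary strings of length at most `n`. -/
def strsUpTo (n : ℕ) : List (List Bool) := (List.range (n + 1)).flatMap allStrs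

theorem mem_strsUpTo {n : ℕ} {s : List Bool} : s ∈ strsUpTo n ↔ s.length ≤ n := by
  simp [strsUpTo, mem_allStrs]

theorem primrec_strsUpTo : Primrec strsUpTo :=
  Primrec.list_flatMap (Primrec.list_range.comp Primrec.succ) (primrec_allStrs.comp Primrec.snd)

theorem nodup_strsUpTo (n : ℕ) : (strsUpTo n).Nodup := by
  rw [strsUpTo, List.nodup_flatMap]
  refine ⟨fun i _ => nodup_allStrs i, List.nodup_range.imp ?_⟩
  intro i j hij s hi hj
  exact hij ((mem_allStrs.1 hi).symm.trans (mem_allStrs.1 hj))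

theorem length_strsUpTo (n : ℕ) : (strsUpTo n).length + 1 = 2 ^ (n + 1) := by
  induction n with
  | zero => rfl
  | succ n ih =>
    have : (strsUpTo (n + 1)).length = (strsUpTo n).length + 2 ^ (n + 1) := by
      rw [strsUpTo, List.range_succ, List.flatMap_append]
      simp [strsUpTo, length_allStrs]
    rw [this, pow_succ 2 (n + 1)]
    omega

theorem strCode_concat (x : List Bool) (b : Bool) :
    strCode (x ++ [b]) = 2 * strCode x + 1 + b.toNat := by
  simp [strCode]

/-- The parity of the code reveals the last bit, and the rest follows by induction from the right.
-/
theorem strCode_injective : Function.Injective strCode := by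
  intro x
  induction x using List.reverseRecOn with
  | nil =>
    intro y
    induction y using List.reverseRecOn with
    | nil => simp
    | append_singleton y b => rw [strCode_concat]; intro h; simp [strCode] at h; omega
  | append_singleton x a ih =>
    intro y
    induction y using List.reverseRecOn with
    | nil => rw [strCode_concat]; simp [strCode]
    | append_singleton y b =>
      rw [strCode_concat, strCode_concat]
      intro h
      have hab : a = b := by
        cases a <;> cases b <;> simp at h ⊢ <;> omega
      subst hab
      rw [ih (show strCode x = strCode y by omega)]

theorem primrec_strCode : Primrec strCode := by
  refine Primrec.list_foldl (h := fun _ (s : ℕ × Bool) => 2 * s.1 + 1 + s.2.toNat) Primrec.id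
    (Primrec.const 0) ?_
  refine Primrec.nat_add.comp (Primrec.nat_add.comp (Primrec.nat_mul.comp (Primrec.const 2)
    (Primrec.fst.comp Primrec.snd)) (Primrec.const 1)) ?_
  exact (Primrec.dom_bool Bool.toNat).comp (Primrec.snd.comp Primrec.snd)

/-- The last `w` binary digits of `v`, most significant digit first. -/
def bitsOf (w v : ℕ) : List Bool :=
  (List.range w).map fun i => decide (v / 2 ^ (w - 1 - i) % 2 = 1)

@[simp] theorem length_bitsOf (w v : ℕ) : (bitsOf w v).length = w := by simp [bitsOf]

theorem primrec_bitsOf : Primrec₂ bitsOf := by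
  refine Primrec.list_map (Primrec.list_range.comp Primrec.fst) ?_
  refine PrimrecPred.decide (Primrec.eq.comp ?_ (Primrec.const 1))
  refine Primrec.nat_mod.comp (Primrec.nat_div.comp (Primrec.snd.comp Primrec.fst)
    (Primrec.nat_pow (Primrec.const 2) (Primrec.nat_sub.comp (Primrec.nat_sub.comp
      (Primrec.fst.comp Primrec.fst) (Primrec.const 1)) Primrec.snd))) (Primrec.const 2)

/-- Truncating a binary expansion on the right is division by a power of two. The bounds on `u` and
`v` guarantee that the digits lose no information. -/
theorem eq_div_of_bitsOf_prefix {a b u v : ℕ} (hu : u < 2 ^ a) (hv : v < 2 ^ b)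
    (h : bitsOf a u <+: bitsOf b v) : a ≤ b ∧ u = v / 2 ^ (b - a) := by
  have hab : a ≤ b := by simpa using h.length_le
  refine ⟨hab, Nat.eq_of_testBit_eq fun j => ?_⟩
  by_cases hj : j < a
  · have h1 : (bitsOf a u)[a - 1 - j]? = (bitsOf b v)[a - 1 - j]? := by
      obtain ⟨t, ht⟩ := h
      rw [← ht, List.getElem?_append_left (by simp; omega)]
    simp only [bitsOf, List.getElem?_map, List.getElem?_range (show a - 1 - j < a by omega),
      List.getElem?_range (show a - 1 - j < b by omega), Option.map_some, Option.some.injEq] at h1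
    rw [show a - 1 - (a - 1 - j) = j by omega,
      show b - 1 - (a - 1 - j) = (b - a) + j by omega, pow_add, ← Nat.div_div_eq_div_mul] at h1
    rw [Nat.testBit_eq_decide_div_mod_eq, Nat.testBit_eq_decide_div_mod_eq, h1]
  · have hle : 2 ^ a ≤ 2 ^ j := Nat.pow_le_pow_right (by norm_num) (not_lt.1 hj)
    rw [Nat.testBit_lt_two_pow (hu.trans_le hle), Nat.testBit_lt_two_pow]
    refine lt_of_lt_of_le ?_ hle
    rw [Nat.div_lt_iff_lt_mul (by positivity), ← pow_add]
    rwa [show a + (b - a) = b by omega]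

/-! ### Shortest programs -/

theorem minLength_le_iff {D : Set (List Bool)} {m : ℕ} :
    minLength D ≤ m ↔ ∃ p ∈ D, p.length ≤ m := by
  constructor
  · intro h
    have hlt : minLength D < ((m + 1 : ℕ) : ℕ∞) :=
      lt_of_le_of_lt h (by exact_mod_cast Nat.lt_succ_self m)
    simp only [minLength, iInf_lt_iff] at hlt
    obtain ⟨p, hp, hl⟩ := hlt
    exact ⟨p, hp, Nat.lt_succ_iff.1 (by exact_mod_cast hl)⟩
  · rintro ⟨p, hp, hl⟩
    exact (iInf₂_le p hp).trans (by exact_mod_cast hl)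

theorem IsShortest.minLength_eq {D : Set (List Bool)} {q : List Bool} (h : IsShortest q D) :
    minLength D = q.length :=
  le_antisymm (iInf₂_le q h.1) (le_iInf₂ fun p hp => by exact_mod_cast h.2 p hp)

theorem exists_isShortest {D : Set (List Bool)} (h : D.Nonempty) : ∃ q, IsShortest q D := by
  obtain ⟨p, hp⟩ := h
  obtain ⟨q, hq, hmin⟩ := WellFounded.has_min (measure (List.length (α := Bool))).wf D ⟨p, hp⟩
  exact ⟨q, hq, fun r hr => not_lt.1 (hmin r hr)⟩

/-! ### Building interpreters and simulating them -/

namespace Interpreter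

theorem Outputs.unique {Φ : Interpreter} {p : List Bool} {y z z' : List ℕ}
    (h : Φ.Outputs p y z) (h' : Φ.Outputs p y z') : z = z' := by
  obtain ⟨s, hs⟩ := h
  obtain ⟨t, ht⟩ := h'
  have h1 := Φ.mono_step s (max s t) p y z (le_max_left _ _) hs
  have h2 := Φ.mono_step t (max s t) p y z' (le_max_right _ _) ht
  exact Option.some.inj (h1.symm.trans h2)

/-- The step-bounded evaluation `evaln` of a code for `f` is computable and monotone in the bound.
The extra test `p.length ≤ t` enforces the length condition and only delays halting. -/
theorem exists_of_partrec {f : List Bool × List ℕ →. List ℕ} (hf : Partrec f) :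
    ∃ Ψ : Interpreter, ∀ p y z, Ψ.Outputs p y z ↔ z ∈ f (p, y) := by
  obtain ⟨c, hc⟩ := Nat.Partrec.Code.exists_code.1 hf
  have hcf : ∀ a z, z ∈ f a ↔ Encodable.encode z ∈ c.eval (Encodable.encode a) := by
    intro a z
    simp [hc, Encodable.encodek]
  let step : ℕ → List Bool → List ℕ → Option (List ℕ) := fun t p y =>
    if p.length ≤ t then (Nat.Partrec.Code.evaln t c (Encodable.encode (p, y))).bind
      fun k => Encodable.decode k else none
  have step_iff : ∀ t p y z, step t p y = some z ↔
      p.length ≤ t ∧ Encodable.encode z ∈ Nat.Partrec.Code.evaln t c (Encodable.encode (p, y)) := by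
    intro t p y z
    by_cases h : p.length ≤ t
    · simp only [step, h, if_true, true_and, Option.bind_eq_some_iff]
      constructor
      · rintro ⟨k, hk, hz⟩
        have hk' := Nat.Partrec.Code.evaln_sound hk
        rw [hc] at hk'
        simp only [Encodable.encodek, Part.coe_some, Part.bind_some, Part.mem_map_iff] at hk'
        obtain ⟨z', -, rfl⟩ := hk'
        rw [Encodable.encodek] at hz
        obtain rfl := Option.some.inj hz
        exact hk
      · intro hz
        exact ⟨_, hz, Encodable.encodek z⟩
    · simp [step, h]
  refine ⟨⟨step, ?_, ?_, ?_⟩, ?_⟩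
  · refine Computable.ite (c := fun a : ℕ × List Bool × List ℕ => a.2.1.length ≤ a.1) ?_ ?_
      (Computable.const none)
    · exact (PrimrecPred.decide (Primrec.nat_le.comp (Primrec.list_length.comp
        (Primrec.fst.comp Primrec.snd)) Primrec.fst)).to_comp
    · refine Primrec.to_comp ?_
      refine Primrec.option_bind ?_ (Primrec.decode.comp Primrec.snd)
      exact Nat.Partrec.Code.primrec_evaln.comp ((Primrec.fst.pair (Primrec.const c)).pair
        (Primrec.encode.comp Primrec.snd))
  · intro s t p y z hst h
    rw [step_iff] at h ⊢
    exact ⟨h.1.trans hst, Nat.Partrec.Code.evaln_mono hst h.2⟩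
  · intro t p y z h
    exact ((step_iff _ _ _ _).1 h).1
  · intro p y z
    rw [hcf, Nat.Partrec.Code.evaln_complete]
    constructor
    · rintro ⟨t, ht⟩
      exact ⟨t, ((step_iff _ _ _ _).1 ht).2⟩
    · rintro ⟨t, ht⟩
      exact ⟨max t p.length, (step_iff _ _ _ _).2 ⟨le_max_right _ _,
        Nat.Partrec.Code.evaln_mono (le_max_left _ _) ht⟩⟩

/-- An optimal interpreter simulates every machine that searches for a witness `w` on which the
computable function `B (p, y)` is defined, and outputs its value. -/
theorem Optimal.exists_search {Φ : Interpreter} (hopt : Φ.Optimal) {ω : Type*} [Primcodable ω]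
    {B : List Bool × List ℕ → ω → Option (List ℕ)} (hB : Computable₂ B)
    (hpf : ∀ y p p' w w' z z', B (p, y) w = some z → B (p', y) w' = some z' → p <+: p' → p = p') :
    ∃ c : ℕ, ∀ p y, (∃ w z, B (p, y) w = some z) →
      ∃ q w z, q.length ≤ p.length + c ∧ B (p, y) w = some z ∧ Φ.Outputs q y z := by
  -- The value may depend on which witness is met first, so the conclusion only promises some `w`;
  -- uniqueness is left to each application.
  let f : List Bool × List ℕ →. List ℕ := fun a =>
    Nat.rfindOpt fun k => (Encodable.decode (α := ω) k).bind (B a)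
  have hf : Partrec f := Partrec.rfindOpt (Computable.bind_decode_iff.2 hB)
  have hmem : ∀ a z, z ∈ f a → ∃ w, B a w = some z := by
    intro a z hz
    obtain ⟨k, hk⟩ := Nat.rfindOpt_spec hz
    obtain ⟨w, -, hw⟩ := Option.bind_eq_some_iff.1 (Option.mem_def.1 hk)
    exact ⟨w, hw⟩
  obtain ⟨Ψ, hΨ⟩ := exists_of_partrec hf
  obtain ⟨c, hc⟩ := hopt Ψ (by
    rintro y p ⟨z, hz⟩ p' ⟨z', hz'⟩ hpp
    obtain ⟨w, hw⟩ := hmem _ _ ((hΨ _ _ _).1 hz)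
    obtain ⟨w', hw'⟩ := hmem _ _ ((hΨ _ _ _).1 hz')
    exact hpf y p p' w w' z z' hw hw' hpp)
  refine ⟨c, fun p y ⟨w, z, hw⟩ => ?_⟩
  have hdom : (f (p, y)).Dom :=
    Nat.rfindOpt_dom.2 ⟨Encodable.encode w, z, by simp [Encodable.encodek, hw]⟩
  obtain ⟨w', hw'⟩ := hmem _ _ (Part.get_mem hdom)
  obtain ⟨q, hq, hout⟩ := hc p y _ ((hΨ _ _ _).2 (Part.get_mem hdom))
  exact ⟨q, w', _, hq, hw', hout⟩

/-- Length-conditional complexity exceeds the length by at most a constant. -/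
theorem Optimal.exists_K_le {Φ : Interpreter} (hopt : Φ.Optimal) :
    ∃ c : ℕ, ∀ x : List Bool, Φ.K x.length x ≤ ((x.length + c : ℕ) : ℕ∞) := by
  -- The machine copies its program if this has length `n`; programs of one fixed length form a
  -- prefix-free set.
  obtain ⟨c, hc⟩ := hopt.exists_search (ω := Unit)
    (B := fun a _ => if a.1.length = a.2.headI then some [strCode a.1] else none) (by
      refine Computable.ite (c := fun a : (List Bool × List ℕ) × Unit =>
        a.1.1.length = a.1.2.headI) ?_ ?_ (Computable.const none)
      · exact (PrimrecPred.decide (Primrec.eq.comp (Primrec.list_length.comp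
          (Primrec.fst.comp Primrec.fst)) (Primrec.list_headI.comp
            (Primrec.snd.comp Primrec.fst)))).to_comp
      · exact (Primrec.option_some.comp (Primrec.list_cons.comp (primrec_strCode.comp
          (Primrec.fst.comp Primrec.fst)) (Primrec.const []))).to_comp)
    (by
      intro y p p' w w' z z' h h' hpp
      refine hpp.eq_of_length ?_
      dsimp only at h h'
      split_ifs at h h' with h1 h2
      exact h1.trans h2.symm)
  refine ⟨c, fun x => minLength_le_iff.2 ?_⟩
  obtain ⟨q, w, z, hq, hB, hout⟩ := hc x [x.length] ⟨(), [strCode x], by simp⟩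
  simp only [List.headI_cons, if_true, Option.some.injEq] at hB
  exact ⟨q, by simpa [hB] using hout, hq⟩

end Interpreter

/-! ### Kraft's inequality -/

/-- Each `p` has `2^(L - p.length)` extensions of length `L`, and prefix-freeness makes these sets
of extensions disjoint. -/
theorem kraft_nat {D : Finset (List Bool)} (hD : IsPrefixFreeSet (D : Set (List Bool))) {L : ℕ}
    (hL : ∀ p ∈ D, p.length ≤ L) : ∑ p ∈ D, 2 ^ (L - p.length) ≤ 2 ^ L := by
  classical
  have hcard : ∀ m, (allStrs m).toFinset.card = 2 ^ m := fun m => by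
    rw [List.toFinset_card_of_nodup (nodup_allStrs m), length_allStrs]
  have hdisj : (D : Set (List Bool)).PairwiseDisjoint
      fun p => (allStrs (L - p.length)).toFinset.image (p ++ ·) := by
    intro p hp q hq hpq
    rw [Function.onFun, Finset.disjoint_left]
    intro s hs hs'
    simp only [Finset.mem_image, List.mem_toFinset] at hs hs'
    obtain ⟨u, -, rfl⟩ := hs
    obtain ⟨v, -, huv⟩ := hs'
    rcases List.prefix_or_prefix_of_prefix (List.prefix_append p u)
      (huv ▸ List.prefix_append q v) with h | h
    · exact hpq (hD p hp q hq h)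
    · exact hpq (hD q hq p hp h).symm
  calc ∑ p ∈ D, 2 ^ (L - p.length)
      = (D.biUnion fun p => (allStrs (L - p.length)).toFinset.image (p ++ ·)).card := by
        rw [Finset.card_biUnion hdisj]
        refine Finset.sum_congr rfl fun p _ => ?_
        rw [Finset.card_image_of_injective _ (List.append_right_injective p), hcard]
    _ ≤ (allStrs L).toFinset.card := by
        refine Finset.card_le_card fun s hs => ?_
        simp only [Finset.mem_biUnion, Finset.mem_image, List.mem_toFinset, mem_allStrs] at hs ⊢
        obtain ⟨p, hp, u, hu, rfl⟩ := hs
        have := hL p hp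
        simp [hu]; omega
    _ = 2 ^ L := hcard L

theorem kraft_real {D : Finset (List Bool)} (hD : IsPrefixFreeSet (D : Set (List Bool))) :
    ∑ p ∈ D, ((1 : ℝ) / 2) ^ p.length ≤ 1 := by
  set L := D.sup List.length
  have hL : ∀ p ∈ D, p.length ≤ L := fun p hp => Finset.le_sup (f := List.length) hp
  have h := kraft_nat hD hL
  have h' : (∑ p ∈ D, (2 : ℝ) ^ (L - p.length)) ≤ 2 ^ L := by exact_mod_cast h
  have heq : ∑ p ∈ D, ((1 : ℝ) / 2) ^ p.length = (∑ p ∈ D, (2 : ℝ) ^ (L - p.length)) / 2 ^ L := by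
    rw [Finset.sum_div]
    refine Finset.sum_congr rfl fun p hp => ?_
    rw [pow_sub₀ _ two_ne_zero (hL p hp), one_div, inv_pow]
    field_simp
  rw [heq]
  exact div_le_one_of_le₀ h' (by positivity)

theorem Primrec.list_sum : Primrec (List.sum : List ℕ → ℕ) :=
  Primrec.list_foldr (h := fun _ s => s.1 + s.2) Primrec.id (Primrec.const 0)
    (Primrec.nat_add.comp (Primrec.fst.comp Primrec.snd) (Primrec.snd.comp Primrec.snd))

/-! ### Approximating `Ω^n` from below -/

namespace Interpreter

variable {Φ : Interpreter}

/-- All programs that halt on `n` within `t` steps, with their outputs. -/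
def snapshot (Φ : Interpreter) (n t : ℕ) : List (List Bool × List ℕ) :=
  (strsUpTo t).filterMap fun p => (Φ.step t p [n]).map (Prod.mk p)

theorem mem_snapshot {n t : ℕ} {e : List Bool × List ℕ} :
    e ∈ Φ.snapshot n t ↔ Φ.step t e.1 [n] = some e.2 := by
  simp only [snapshot, List.mem_filterMap, mem_strsUpTo, Option.map_eq_some_iff]
  constructor
  · rintro ⟨p, -, o, h, rfl⟩
    exact h
  · intro h
    exact ⟨e.1, Φ.length_le_of_step _ _ _ _ h, e.2, h, rfl⟩

theorem computable_snapshot (Φ : Interpreter) : Computable₂ Φ.snapshot := by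
  refine Computable.list_filterMap (primrec_strsUpTo.to_comp.comp Computable.snd) ?_
  refine Computable.option_map (Φ.computable_step.comp
    ((Computable.snd.comp Computable.fst).pair (Computable.snd.pair
      (Computable.list_cons.comp (Computable.fst.comp Computable.fst) (Computable.const []))))) ?_
  exact (Computable.snd.comp Computable.fst).pair Computable.snd

end Interpreter

/-- The output tuple `o` consists of a single binary string of length `n`. -/
def IsStrOutput (n : ℕ) (o : List ℕ) : Prop := ∃ x ∈ allStrs n, o = [strCode x]

instance (n : ℕ) (o : List ℕ) : Decidable (IsStrOutput n o) := by
  unfold IsStrOutput; infer_instance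

theorem primrecRel_isStrOutput : PrimrecRel IsStrOutput := by
  have h : PrimrecRel fun (x : List Bool) (o : List ℕ) => o = [strCode x] :=
    Primrec.eq.comp Primrec.snd (Primrec.list_cons.comp (primrec_strCode.comp Primrec.fst)
      (Primrec.const []))
  exact (PrimrecRel.exists_mem_list h).comp (primrec_allStrs.comp Primrec.fst) Primrec.snd

namespace Interpreter

variable {Φ : Interpreter}

/-- The numerator of `Ω^n_t` over the denominator `2^t`. -/
def omegaNum (Φ : Interpreter) (n t : ℕ) : ℕ :=
  ((Φ.snapshot n t).map fun e => if IsStrOutput n e.2 then 2 ^ (t - e.1.length) else 0).sum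

theorem computable_omegaNum (Φ : Interpreter) : Computable₂ Φ.omegaNum := by
  have h : Primrec fun a : (ℕ × ℕ) × List (List Bool × List ℕ) => a.2.map fun e =>
      if IsStrOutput a.1.1 e.2 then 2 ^ (a.1.2 - e.1.length) else 0 := by
    refine Primrec.list_map Primrec.snd (Primrec.ite ?_ ?_ (Primrec.const 0))
    · exact primrecRel_isStrOutput.comp (Primrec.fst.comp (Primrec.fst.comp Primrec.fst))
        (Primrec.snd.comp Primrec.snd)
    · exact Primrec.nat_pow (Primrec.const 2) (Primrec.nat_sub.comp
        (Primrec.snd.comp (Primrec.fst.comp Primrec.fst))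
        (Primrec.list_length.comp (Primrec.fst.comp Primrec.snd)))
  have h' := Primrec.list_sum.to_comp.comp
    (h.to_comp.comp (Computable.id.pair Φ.computable_snapshot))
  exact h'

open Classical in
/-- The programs that output a string of length `n` within `t` steps. -/
noncomputable def haltSet (Φ : Interpreter) (n t : ℕ) : Finset (List Bool) :=
  (strsUpTo t).toFinset.filter fun p => ∃ x : List Bool, x.length = n ∧
    Φ.step t p [n] = some [strCode x]

theorem mem_haltSet {n t : ℕ} {p : List Bool} : p ∈ Φ.haltSet n t ↔
    ∃ x : List Bool, x.length = n ∧ Φ.step t p [n] = some [strCode x] := by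
  simp only [haltSet, Finset.mem_filter, List.mem_toFinset, mem_strsUpTo, and_iff_right_iff_imp]
  rintro ⟨x, -, h⟩
  exact Φ.length_le_of_step _ _ _ _ h

theorem stageOmega_eq_sum (Φ : Interpreter) (n t : ℕ) :
    Φ.stageOmega n t = ∑ p ∈ Φ.haltSet n t, ((1 : ℝ) / 2) ^ p.length := by
  classical
  rw [stageOmega, tsum_eq_sum (s := Φ.haltSet n t)]
  · refine Finset.sum_congr rfl fun p hp => ?_
    rw [if_pos (mem_haltSet.1 hp)]
  · intro p hp
    rw [if_neg fun h => hp (mem_haltSet.2 h)]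

/-- Programs that halt within `t` steps have at most `t` bits, so `2^t` is a common denominator. -/
theorem stageOmega_eq_div (Φ : Interpreter) (n t : ℕ) :
    Φ.stageOmega n t = (Φ.omegaNum n t : ℝ) / 2 ^ t := by
  classical
  have hnat : Φ.omegaNum n t = ∑ p ∈ Φ.haltSet n t, 2 ^ (t - p.length) := by
    have hlist : ∀ l : List (List Bool),
        ((l.filterMap fun p => (Φ.step t p [n]).map (Prod.mk p)).map fun e =>
          if IsStrOutput n e.2 then 2 ^ (t - e.1.length) else 0).sum =
        (l.map fun p => if ∃ x : List Bool, x.length = n ∧ Φ.step t p [n] = some [strCode x]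
          then 2 ^ (t - p.length) else 0).sum := by
      intro l
      induction l with
      | nil => rfl
      | cons p l ih =>
        cases h : Φ.step t p [n] with
        | none => simp [h, ih]
        | some o =>
          simp only [List.filterMap_cons, List.map_cons, List.sum_cons, h, Option.map_some, ih,
            Option.some.injEq]
          simp only [IsStrOutput, mem_allStrs]
    rw [omegaNum, snapshot, hlist, haltSet, Finset.sum_filter,
      List.sum_toFinset _ (nodup_strsUpTo t)]
  rw [stageOmega_eq_sum, hnat, Nat.cast_sum, Finset.sum_div]
  refine Finset.sum_congr rfl fun p hp => ?_
  obtain ⟨x, -, h⟩ := mem_haltSet.1 hp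
  have hle := Φ.length_le_of_step _ _ _ _ h
  push_cast
  rw [pow_sub₀ _ two_ne_zero hle, one_div, inv_pow]
  field_simp

theorem haltSet_mono (Φ : Interpreter) (n : ℕ) : Monotone (Φ.haltSet n) := by
  intro s t hst p hp
  obtain ⟨x, hx, h⟩ := mem_haltSet.1 hp
  exact mem_haltSet.2 ⟨x, hx, Φ.mono_step _ _ _ _ _ hst h⟩

theorem stageOmega_mono (Φ : Interpreter) (n : ℕ) : Monotone (Φ.stageOmega n) := by
  intro s t hst
  rw [stageOmega_eq_sum, stageOmega_eq_sum]
  exact Finset.sum_le_sum_of_subset_of_nonneg (haltSet_mono Φ n hst) fun _ _ _ => by positivity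

theorem PrefixFree.stageOmega_le_one (hpf : Φ.PrefixFree) (n t : ℕ) : Φ.stageOmega n t ≤ 1 := by
  rw [stageOmega_eq_sum]
  refine kraft_real fun p hp q hq hpq => hpf [n] p ?_ q ?_ hpq
  · obtain ⟨x, -, h⟩ := mem_haltSet.1 (Finset.mem_coe.1 hp)
    exact ⟨_, t, h⟩
  · obtain ⟨x, -, h⟩ := mem_haltSet.1 (Finset.mem_coe.1 hq)
    exact ⟨_, t, h⟩

theorem PrefixFree.tendsto_stageOmega (hpf : Φ.PrefixFree) (n : ℕ) :
    Filter.Tendsto (Φ.stageOmega n) Filter.atTop (nhds (Φ.Omega n)) :=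
  tendsto_nhds_limUnder ⟨_, tendsto_atTop_ciSup (Φ.stageOmega_mono n)
    ⟨1, by rintro _ ⟨t, rfl⟩; exact hpf.stageOmega_le_one n t⟩⟩

theorem PrefixFree.stageOmega_le_Omega (hpf : Φ.PrefixFree) (n t : ℕ) :
    Φ.stageOmega n t ≤ Φ.Omega n :=
  (Φ.stageOmega_mono n).ge_of_tendsto (hpf.tendsto_stageOmega n) t

/-- Convergence makes the set of admissible times nonempty, so the infimum defining `omegaTime` is
attained; later times are admissible by monotonicity. -/
theorem PrefixFree.Omega_sub_le_of_omegaTime_le (hpf : Φ.PrefixFree) {n k t : ℕ}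
    (h : Φ.omegaTime n k ≤ t) : Φ.Omega n - Φ.stageOmega n t ≤ ((1 : ℝ) / 2) ^ k := by
  have hne : {t | Φ.Omega n - Φ.stageOmega n t ≤ ((1 : ℝ) / 2) ^ k}.Nonempty := by
    have hlt : Φ.Omega n - ((1 : ℝ) / 2) ^ k < Φ.Omega n := by
      have : (0 : ℝ) < (1 / 2) ^ k := by positivity
      linarith
    obtain ⟨t, ht⟩ := ((hpf.tendsto_stageOmega n).eventually_const_lt hlt).exists
    exact ⟨t, by simp only [Set.mem_ofPred_eq]; linarith⟩
  have h1 := Nat.sInf_mem hne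
  have h2 := Φ.stageOmega_mono n h
  simp only [Set.mem_ofPred_eq] at h1
  exact (sub_le_sub_left h2 _).trans h1

/-- A program that has not halted contributes to `Ω^n` later. -/
theorem PrefixFree.stageOmega_add_le_Omega (hpf : Φ.PrefixFree) {t : ℕ} {p x : List Bool}
    (hout : Φ.Outputs p [x.length] [strCode x])
    (hnot : Φ.step t p [x.length] ≠ some [strCode x]) :
    Φ.stageOmega x.length t + ((1 : ℝ) / 2) ^ p.length ≤ Φ.Omega x.length := by
  classical
  have hp : p ∉ Φ.haltSet x.length t := by
    intro h
    obtain ⟨x', -, h'⟩ := mem_haltSet.1 h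
    rw [hout.unique ⟨t, h'⟩] at hnot
    exact hnot h'
  obtain ⟨s, hs⟩ := hout
  refine le_trans ?_ (hpf.stageOmega_le_Omega x.length (max s t))
  rw [stageOmega_eq_sum, stageOmega_eq_sum, add_comm,
    ← Finset.sum_insert (f := fun p : List Bool => ((1 : ℝ) / 2) ^ p.length) hp]
  refine Finset.sum_le_sum_of_subset_of_nonneg ?_ fun _ _ _ => by positivity
  refine Finset.insert_subset ?_ (haltSet_mono Φ _ (le_max_right _ _))
  exact mem_haltSet.2 ⟨x, rfl, Φ.mono_step _ _ _ _ _ (le_max_left _ _) hs⟩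

/-- Short programs have halted as soon as `Ω^n` is known with sufficient precision. -/
theorem PrefixFree.step_of_omegaTime_le (hpf : Φ.PrefixFree) {k t : ℕ} {p x : List Bool}
    (hout : Φ.Outputs p [x.length] [strCode x]) (ht : Φ.omegaTime x.length k ≤ t)
    (hp : p.length < k) : Φ.step t p [x.length] = some [strCode x] := by
  by_contra hnot
  have h1 := hpf.stageOmega_add_le_Omega hout hnot
  have h2 := hpf.Omega_sub_le_of_omegaTime_le ht
  have h3 : ((1 : ℝ) / 2) ^ k < (1 / 2) ^ p.length :=
    pow_lt_pow_right_of_lt_one₀ (by norm_num) (by norm_num) hp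
  linarith

/-- The m-depth of `x` exceeds its complexity by at most one. -/
theorem PrefixFree.mDepth_le (hpf : Φ.PrefixFree) {d m : ℕ} {x : List Bool}
    (h : Φ.K x.length x ≤ m) : Φ.mDepth d x ≤ m + 1 := by
  obtain ⟨p, hp, hpm⟩ := minLength_le_iff.1 h
  obtain ⟨q, hq⟩ := exists_isShortest ⟨p, hp⟩
  have hqm : q.length ≤ m := (hq.2 p hp).trans hpm
  refine Nat.sInf_le ?_
  have hstep := hpf.step_of_omegaTime_le (k := m + 1) hq.1 le_rfl (by omega)
  have hK : Φ.K x.length x = q.length := hq.minLength_eq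
  simp only [Set.mem_ofPred_eq, hK]
  exact (minLength_le_iff.2 ⟨q, hstep, le_rfl⟩).trans le_self_add

/-- A time within which `x` is produced by a nearly shortest program exceeds `t_k` for every `k`
below the m-depth of `x`. -/
theorem omegaTime_lt_of_stageK_le {d k t : ℕ} {x : List Bool} (hk : k < Φ.mDepth d x)
    (h : Φ.stageK x.length t x ≤ Φ.K x.length x + d) : Φ.omegaTime x.length k < t := by
  by_contra hle
  refine Nat.notMem_of_lt_sInf hk ?_
  refine le_trans ?_ h
  refine le_iInf₂ fun p hp => iInf₂_le p ?_
  exact Φ.mono_step _ _ _ _ _ (not_lt.1 hle) hp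

/-- The bits of `Ω^n` are determined by an approximation of `Ω^n` from below and one of three
corrections. -/
theorem PrefixFree.exists_omegaBits_eq (hpf : Φ.PrefixFree) {n k t : ℕ}
    (h : 0 < k → Φ.omegaTime n (k - 1) ≤ t) :
    ∃ a ≤ 2, Φ.omegaBits n k = bitsOf k (2 ^ k * Φ.omegaNum n t / 2 ^ t + a) := by
  rcases Nat.eq_zero_or_pos k with rfl | hk
  · exact ⟨0, by omega, by simp [omegaBits, bitsOf]⟩
  have h1 := hpf.Omega_sub_le_of_omegaTime_le (h hk)
  have h2 := hpf.stageOmega_le_Omega n t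
  have hV : 2 ^ k * Φ.omegaNum n t / 2 ^ t = ⌊(2 : ℝ) ^ k * Φ.stageOmega n t⌋₊ := by
    rw [stageOmega_eq_div, ← Nat.floor_div_eq_div (K := ℝ)]
    push_cast
    rw [mul_div_assoc]
  -- Precision is available only at `k - 1`, so after scaling by `2^k` the error is at most 2. This
  -- is why there are three possible corrections.
  have hk2 : (2 : ℝ) ^ k * (1 / 2) ^ (k - 1) = 2 := by
    obtain ⟨j, rfl⟩ : ∃ j, k = j + 1 := ⟨k - 1, by omega⟩
    rw [Nat.add_sub_cancel, pow_succ, mul_right_comm, ← mul_pow]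
    norm_num
  have hpos : (0 : ℝ) < 2 ^ k := by positivity
  have hlow : ⌊(2 : ℝ) ^ k * Φ.stageOmega n t⌋₊ ≤ ⌊(2 : ℝ) ^ k * Φ.Omega n⌋₊ :=
    Nat.floor_le_floor (by gcongr)
  have h0 : 0 ≤ Φ.stageOmega n t := by rw [stageOmega_eq_div]; positivity
  have hup : ⌊(2 : ℝ) ^ k * Φ.Omega n⌋₊ ≤ ⌊(2 : ℝ) ^ k * Φ.stageOmega n t⌋₊ + 2 := by
    rw [← Nat.floor_add_ofNat (by positivity)]
    refine Nat.floor_le_floor ?_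
    have := mul_le_mul_of_nonneg_left h1 hpos.le
    rw [hk2] at this
    linarith
  refine ⟨⌊(2 : ℝ) ^ k * Φ.Omega n⌋₊ - ⌊(2 : ℝ) ^ k * Φ.stageOmega n t⌋₊, by omega, ?_⟩
  rw [hV, Nat.add_sub_cancel' hlow, omegaBits, bitsOf]
  refine List.ext_getElem (by simp) fun i hi hi' => ?_
  have hik : i < k := by simpa using hi
  -- The integer part of `2^(i+1) Ω^n` is that of `2^k Ω^n` without its last `k - 1 - i` binary
  -- digits.
  have : ⌊(2 : ℝ) ^ (i + 1) * Φ.Omega n⌋₊ = ⌊(2 : ℝ) ^ k * Φ.Omega n⌋₊ / 2 ^ (k - 1 - i) := by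
    rw [← Nat.floor_div_natCast]
    congr 1
    push_cast
    rw [eq_div_iff (by positivity), mul_right_comm, ← pow_add]
    congr 2
    omega
  simp [this]

end Interpreter

/-! ### Two-part descriptions -/

/-- No codeword of the table is a prefix of another one. -/
def PrefixFreeTable (L : List (List Bool × ℕ)) : Prop :=
  ∀ e ∈ L, ∀ e' ∈ L, e.1 <+: e'.1 → e = e'

instance (L : List (List Bool × ℕ)) : Decidable (PrefixFreeTable L) := by
  unfold PrefixFreeTable; infer_instance

theorem primrecPred_prefixFreeTable : PrimrecPred PrefixFreeTable := by
  have hR : PrimrecRel fun (e' e : List Bool × ℕ) => e.1 <+: e'.1 → e = e' := by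
    have h1 : PrimrecRel fun (e' e : List Bool × ℕ) => e.1 = e'.1.take e.1.length :=
      Primrec.eq.comp (Primrec.fst.comp Primrec.snd) (Primrec.list_take.comp
        (Primrec.list_length.comp (Primrec.fst.comp Primrec.snd)) (Primrec.fst.comp Primrec.fst))
    have h2 : PrimrecRel fun (e' e : List Bool × ℕ) => e = e' :=
      Primrec.eq.comp Primrec.snd Primrec.fst
    refine ((PrimrecPred.not h1).or h2).of_eq fun a => ?_
    show _ ↔ (a.2.1 <+: a.1.1 → a.2 = a.1)
    rw [List.prefix_iff_eq_take, imp_iff_not_or]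
  have h1 : PrimrecRel fun (e : List Bool × ℕ) (L : List (List Bool × ℕ)) =>
      ∀ e' ∈ L, e.1 <+: e'.1 → e = e' :=
    (PrimrecRel.forall_mem_list hR).comp Primrec.snd Primrec.fst
  exact (PrimrecRel.forall_mem_list h1).comp Primrec.id Primrec.id

/-- The table itself if it is prefix-free, the empty table otherwise. -/
def guardTable (L : List (List Bool × ℕ)) : List (List Bool × ℕ) :=
  if PrefixFreeTable L then L else []

theorem primrec_guardTable : Primrec guardTable :=
  Primrec.ite primrecPred_prefixFreeTable Primrec.id (Primrec.const [])

/-- The guard also covers outputs of programs that compute no model at all, so the two-part machine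
is prefix-free on all its inputs. -/
theorem prefixFreeTable_guardTable (L : List (List Bool × ℕ)) :
    PrefixFreeTable (guardTable L) := by
  unfold guardTable
  split_ifs with h
  · exact h
  · simp [PrefixFreeTable]

theorem PrefixFreeTable.lookup_eq {L : List (List Bool × ℕ)} (hL : PrefixFreeTable L)
    {w : List Bool} {z : ℕ} (h : (w, z) ∈ L) : L.lookup w = some z := by
  induction L with
  | nil => simp at h
  | cons e L ih =>
    obtain ⟨w', z'⟩ := e
    by_cases hw : w = w'
    · subst hw
      have := hL (w, z) h (w, z') (by simp) (List.prefix_refl w)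
      simp only [Prod.mk.injEq, true_and] at this
      simp [this]
    · have hmem : (w, z) ∈ L := by
        rcases List.mem_cons.1 h with h | h
        · exact absurd (Prod.ext_iff.1 h).1 hw
        · exact h
      rw [List.lookup_cons, beq_false_of_ne hw]
      exact ih (fun a ha b hb => hL a (List.mem_cons_of_mem _ ha) b (List.mem_cons_of_mem _ hb))
        hmem

theorem mem_of_lookup_eq_some {L : List (List Bool × ℕ)} {w : List Bool} {z : ℕ}
    (h : L.lookup w = some z) : (w, z) ∈ L := by
  induction L with
  | nil => simp at h
  | cons e L ih =>
    obtain ⟨w', z'⟩ := e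
    rw [List.lookup_cons] at h
    by_cases hw : w = w'
    · subst hw
      simp at h
      simp [h]
    · rw [beq_false_of_ne hw] at h
      exact List.mem_cons_of_mem _ (ih h)

/-- A kind of models: for every `n` a list of labels, for every label an input on which a program
for a model is run, and a way to turn the outputs into a table of pairs (codeword, string). -/
structure ModelKind where
  labels : ℕ → List (List Bool)
  input : ℕ → List Bool → List ℕ
  table : ℕ → List (List Bool × List ℕ) → List (List Bool × ℕ)
  computable_labels : Computable labels
  computable_input : Computable₂ input
  computable_table : Computable₂ table
  labels_ne_nil : ∀ n, labels n ≠ []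

namespace ModelKind

variable (M : ModelKind) (Φ : Interpreter)

/-- The program `q` outputs `out y` for every label `y`. -/
def Computes (n : ℕ) (q : List Bool) (out : List Bool → List ℕ) : Prop :=
  ∀ y ∈ M.labels n, Φ.Outputs q (M.input n y) (out y)

/-- The prefix-free table that is determined by the outputs `out`. -/
def codeTable (n : ℕ) (out : List Bool → List ℕ) : List (List Bool × ℕ) :=
  guardTable (M.table n ((M.labels n).map fun y => (y, out y)))

/-- The outputs of `q` that are available after `t` steps. -/
def results (n : ℕ) (q : List Bool) (t : ℕ) : List (List Bool × List ℕ) :=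
  (M.labels n).filterMap fun y => (Φ.step t q (M.input n y)).map (Prod.mk y)

/-- The program `q` has halted within `t` steps for all labels. -/
def IsDone (n : ℕ) (q : List Bool) (t : ℕ) : Prop :=
  (M.results Φ n q t).length = (M.labels n).length

instance (n : ℕ) (q : List Bool) (t : ℕ) : Decidable (M.IsDone Φ n q t) := by
  unfold IsDone; infer_instance

theorem computable_results :
    Computable fun a : ℕ × List Bool × ℕ => M.results Φ a.1 a.2.1 a.2.2 := by
  have h : Computable fun b : (ℕ × List Bool × ℕ) × List Bool =>
      Φ.step b.1.2.2 b.1.2.1 (M.input b.1.1 b.2) := by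
    have h1 : Computable fun b : (ℕ × List Bool × ℕ) × List Bool => M.input b.1.1 b.2 :=
      M.computable_input.comp (Computable.fst.comp Computable.fst) Computable.snd
    have h2 : Computable fun b : (ℕ × List Bool × ℕ) × List Bool => b.1.2 :=
      Computable.snd.comp Computable.fst
    have h3 := Φ.computable_step.comp
      ((Computable.snd.comp h2).pair ((Computable.fst.comp h2).pair h1))
    exact h3
  have hmk : Computable₂ fun (b : (ℕ × List Bool × ℕ) × List Bool) (o : List ℕ) => (b.2, o) :=
    (Computable.snd.comp Computable.fst).pair Computable.snd
  exact Computable.list_filterMap (M.computable_labels.comp Computable.fst)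
    (Computable.option_map h hmk)

theorem computable_isDone :
    Computable fun a : ℕ × List Bool × ℕ => decide (M.IsDone Φ a.1 a.2.1 a.2.2) := by
  have h1 : Computable fun a : ℕ × List Bool × ℕ => (M.results Φ a.1 a.2.1 a.2.2).length :=
    Computable.list_length.comp (M.computable_results Φ)
  have h2 : Computable fun a : ℕ × List Bool × ℕ => (M.labels a.1).length :=
    Computable.list_length.comp (M.computable_labels.comp Computable.fst)
  exact (Computable.decide_nat_eq h1 h2).of_eq fun a => rfl

theorem computable_guardTable : Computable fun a : ℕ × List Bool × ℕ =>
    guardTable (M.table a.1 (M.results Φ a.1 a.2.1 a.2.2)) :=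
  primrec_guardTable.to_comp.comp
    (M.computable_table.comp Computable.fst (M.computable_results Φ))

variable {M Φ}

theorem isDone_iff {n : ℕ} {q : List Bool} {t : ℕ} :
    M.IsDone Φ n q t ↔ ∀ y ∈ M.labels n, (Φ.step t q (M.input n y)).isSome := by
  unfold IsDone results
  generalize M.labels n = l
  induction l with
  | nil => simp
  | cons y l ih =>
    cases h : Φ.step t q (M.input n y) with
    | none =>
      have := List.length_filterMap_le
        (fun y => (Φ.step t q (M.input n y)).map (Prod.mk y)) l
      simp [h]; omega
    | some o => simp [h, ih]

theorem Computes.results_eq {n : ℕ} {q : List Bool} {out : List Bool → List ℕ} {t : ℕ}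
    (hq : M.Computes Φ n q out) (ht : M.IsDone Φ n q t) :
    M.results Φ n q t = (M.labels n).map fun y => (y, out y) := by
  rw [isDone_iff] at ht
  rw [results, ← List.filterMap_eq_map]
  refine List.filterMap_congr fun y hy => ?_
  obtain ⟨o, ho⟩ := Option.isSome_iff_exists.1 (ht y hy)
  rw [ho, Interpreter.Outputs.unique ⟨t, ho⟩ (hq y hy)]
  rfl

theorem IsDone.exists_computes {n : ℕ} {q : List Bool} {t : ℕ} (ht : M.IsDone Φ n q t) :
    ∃ out, M.Computes Φ n q out := by
  rw [isDone_iff] at ht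
  refine ⟨fun y => (Φ.step t q (M.input n y)).getD [], fun y hy => ⟨t, ?_⟩⟩
  obtain ⟨o, ho⟩ := Option.isSome_iff_exists.1 (ht y hy)
  simp [ho]

theorem IsDone.mono {n : ℕ} {q : List Bool} {s t : ℕ} (hst : s ≤ t) (h : M.IsDone Φ n q s) :
    M.IsDone Φ n q t := by
  rw [isDone_iff] at h ⊢
  intro y hy
  obtain ⟨o, ho⟩ := Option.isSome_iff_exists.1 (h y hy)
  rw [Φ.mono_step _ _ _ _ _ hst ho]
  rfl

theorem Computes.eventually_isDone {n : ℕ} {q : List Bool} {out : List Bool → List ℕ}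
    (hq : M.Computes Φ n q out) : ∀ᶠ t in Filter.atTop, M.IsDone Φ n q t := by
  have : ∀ᶠ t in Filter.atTop, ∀ y ∈ (M.labels n).toFinset,
      (Φ.step t q (M.input n y)).isSome := by
    rw [Filter.eventually_all_finset]
    intro y hy
    obtain ⟨s, hs⟩ := hq y (List.mem_toFinset.1 hy)
    filter_upwards [Filter.eventually_ge_atTop s] with t ht
    rw [Φ.mono_step _ _ _ _ _ ht hs]
    rfl
  filter_upwards [this] with t ht
  exact isDone_iff.2 fun y hy => ht y (List.mem_toFinset.2 hy)

/-- Both programs halt on the input of a common label, where `Φ` is prefix-free. This is the purpose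
of `labels_ne_nil`. -/
theorem IsDone.eq_of_prefix (hpf : Φ.PrefixFree) {n : ℕ} {q q' : List Bool} {t t' : ℕ}
    (h : M.IsDone Φ n q t) (h' : M.IsDone Φ n q' t') (hqq : q <+: q') : q = q' := by
  obtain ⟨y, hy⟩ := List.exists_mem_of_ne_nil _ (M.labels_ne_nil n)
  obtain ⟨o, ho⟩ := Option.isSome_iff_exists.1 (isDone_iff.1 h y hy)
  obtain ⟨o', ho'⟩ := Option.isSome_iff_exists.1 (isDone_iff.1 h' y hy)
  exact hpf (M.input n y) q ⟨o, t, ho⟩ q' ⟨o', t', ho'⟩ hqq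

theorem IsDone.guardTable_eq {n : ℕ} {q : List Bool} {t t' : ℕ}
    (h : M.IsDone Φ n q t) (h' : M.IsDone Φ n q t') :
    guardTable (M.table n (M.results Φ n q t)) = guardTable (M.table n (M.results Φ n q t')) := by
  obtain ⟨out, hout⟩ := h.exists_computes
  rw [hout.results_eq h, hout.results_eq h']

/-- Two-part codes: a program for a model followed by a codeword yields a description. -/
theorem exists_two_part (M : ModelKind) (hpf : Φ.PrefixFree) (hopt : Φ.Optimal) :
    ∃ c : ℕ, ∀ n q out, M.Computes Φ n q out → ∀ e ∈ M.codeTable n out,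
      ∃ p : List Bool, p.length ≤ q.length + e.1.length + c ∧ Φ.Outputs p [n] [e.2] := by
  let B : List Bool × List ℕ → List Bool × List Bool × ℕ → Option (List ℕ) := fun a w =>
    if w.1 ++ w.2.1 = a.1 ∧ M.IsDone Φ a.2.headI w.1 w.2.2 then
      ((guardTable (M.table a.2.headI (M.results Φ a.2.headI w.1 w.2.2))).lookup w.2.1).map
        fun z => [z]
    else none
  have hproj : Computable fun a : (List Bool × List ℕ) × List Bool × List Bool × ℕ =>
      (a.1.2.headI, a.2.1, a.2.2.2) :=
    (Primrec.list_headI.comp (Primrec.snd.comp Primrec.fst)).to_comp.pair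
      ((Primrec.fst.comp Primrec.snd).to_comp.pair
        (Primrec.snd.comp (Primrec.snd.comp Primrec.snd)).to_comp)
  have hB : Computable₂ B := by
    refine Computable.ite (c := fun a : (List Bool × List ℕ) × List Bool × List Bool × ℕ =>
      a.2.1 ++ a.2.2.1 = a.1.1 ∧ M.IsDone Φ a.1.2.headI a.2.1 a.2.2.2) ?_ ?_ (Computable.const none)
    · have h1 : Computable fun a : (List Bool × List ℕ) × List Bool × List Bool × ℕ =>
          decide (a.2.1 ++ a.2.2.1 = a.1.1) :=
        (PrimrecPred.decide (Primrec.eq.comp (Primrec.list_append.comp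
          (Primrec.fst.comp Primrec.snd) (Primrec.fst.comp (Primrec.snd.comp Primrec.snd)))
          (Primrec.fst.comp Primrec.fst))).to_comp
      exact (Primrec.and.to_comp.comp h1 ((M.computable_isDone Φ).comp hproj)).of_eq
        fun a => by simp
    · have h1 : Computable fun a : (List Bool × List ℕ) × List Bool × List Bool × ℕ => guardTable
          (M.table a.1.2.headI (M.results Φ a.1.2.headI a.2.1 a.2.2.2)) :=
        (M.computable_guardTable Φ).comp hproj
      have h2 : Computable fun a : (List Bool × List ℕ) × List Bool × List Bool × ℕ => a.2.2.1 :=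
        (Primrec.fst.comp (Primrec.snd.comp Primrec.snd)).to_comp
      have h3 : Computable₂ (List.lookup : List Bool → List (List Bool × ℕ) → Option ℕ) := by
        rw [lawful_beq_subsingleton (List.instBEq : BEq (List Bool)) instBEqOfDecidableEq]
        exact Primrec.listLookup.to_comp
      refine Computable.option_map (h3.comp h2 h1) ?_
      exact Computable.list_cons.comp Computable.snd (Computable.const [])
  obtain ⟨c, hc⟩ := hopt.exists_search hB (by
    rintro y p p' ⟨q, w, t⟩ ⟨q', w', t'⟩ z z' h h' hpp
    dsimp only [B] at h h'
    split_ifs at h h' with h1 h2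
    obtain ⟨rfl, hd⟩ := h1
    obtain ⟨rfl, hd'⟩ := h2
    -- Both model programs are prefixes of the longer input, hence comparable, hence equal. They
    -- then share one table, whose prefix-freeness settles the codewords.
    obtain rfl : q = q' := by
      rcases List.prefix_or_prefix_of_prefix ((List.prefix_append q w).trans hpp)
        (List.prefix_append q' w') with hqq | hqq
      · exact hd.eq_of_prefix hpf hd' hqq
      · exact (hd'.eq_of_prefix hpf hd hqq).symm
    rw [hd.guardTable_eq hd'] at h
    obtain ⟨v, hv, -⟩ := Option.map_eq_some_iff.1 h
    obtain ⟨v', hv', -⟩ := Option.map_eq_some_iff.1 h'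
    have := prefixFreeTable_guardTable _ _ (mem_of_lookup_eq_some hv) _
      (mem_of_lookup_eq_some hv') ((List.prefix_append_right_inj q).1 hpp)
    rw [show w = w' from (Prod.ext_iff.1 this).1])
  refine ⟨c, fun n q out hq e he => ?_⟩
  obtain ⟨t, ht⟩ := hq.eventually_isDone.exists
  have hval : B (q ++ e.1, [n]) (q, e.1, t) = some [e.2] := by
    simp only [B, List.headI_cons, true_and, if_pos ht, hq.results_eq ht]
    rw [(prefixFreeTable_guardTable _).lookup_eq (z := e.2) he]
    rfl
  obtain ⟨p, ⟨q', w', t'⟩, z, hp, hw, hout⟩ := hc (q ++ e.1) [n] ⟨_, _, hval⟩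
  refine ⟨p, by simpa using hp, ?_⟩
  dsimp only [B] at hw
  split_ifs at hw with h1
  dsimp only [List.headI_cons] at h1 hw
  obtain ⟨h1, hd'⟩ := h1
  -- The search may have met another splitting of the input or another time; the splitting is unique
  -- for the same reason, and the table does not depend on the time.
  obtain rfl : q' = q := by
    rcases List.prefix_or_prefix_of_prefix (h1 ▸ List.prefix_append q' w')
      (List.prefix_append q e.1) with hqq | hqq
    · exact hd'.eq_of_prefix hpf ht hqq
    · exact (ht.eq_of_prefix hpf hd' hqq).symm
  obtain rfl : w' = e.1 := List.append_cancel_left h1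
  rw [hq.results_eq hd', (prefixFreeTable_guardTable _).lookup_eq (z := e.2) he] at hw
  simp only [Option.map_some, Option.some.injEq] at hw
  rwa [hw]

variable (M Φ) in
/-- After `t` steps the table of `q` is available, and all its entries have been produced by
programs whose lengths exceed those of the two-part descriptions by at most `c`. -/
def IsCovered (c n : ℕ) (q : List Bool) (t : ℕ) : Prop :=
  M.IsDone Φ n q t ∧ ∀ e ∈ guardTable (M.table n (M.results Φ n q t)),
    ∃ s ∈ Φ.snapshot n t, s.1.length ≤ q.length + e.1.length + c ∧ s.2 = [e.2]

instance (c n : ℕ) (q : List Bool) (t : ℕ) : Decidable (M.IsCovered Φ c n q t) := by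
  unfold IsCovered; infer_instance

variable (M Φ) in
theorem computable_isCovered (c : ℕ) :
    Computable fun a : ℕ × List Bool × ℕ => decide (M.IsCovered Φ c a.1 a.2.1 a.2.2) := by
  have hS : PrimrecRel fun (s : List Bool × List ℕ) (b : (List Bool × ℕ) × ℕ) =>
      s.1.length ≤ b.2 + b.1.1.length + c ∧ s.2 = [b.1.2] := by
    refine PrimrecPred.and ?_ ?_
    · exact Primrec.nat_le.comp (Primrec.list_length.comp (Primrec.fst.comp Primrec.fst))
        (Primrec.nat_add.comp (Primrec.nat_add.comp (Primrec.snd.comp Primrec.snd)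
          (Primrec.list_length.comp (Primrec.fst.comp (Primrec.fst.comp Primrec.snd))))
          (Primrec.const c))
    · exact Primrec.eq.comp (Primrec.snd.comp Primrec.fst) (Primrec.list_cons.comp
        (Primrec.snd.comp (Primrec.fst.comp Primrec.snd)) (Primrec.const []))
  have hE : PrimrecRel fun (e : List Bool × ℕ) (b : List (List Bool × List ℕ) × ℕ) =>
      ∃ s ∈ b.1, s.1.length ≤ b.2 + e.1.length + c ∧ s.2 = [e.2] :=
    (PrimrecRel.exists_mem_list hS).comp (Primrec.fst.comp Primrec.snd)
      (Primrec.fst.pair (Primrec.snd.comp Primrec.snd))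
  have hsnap : Computable fun a : ℕ × List Bool × ℕ => Φ.snapshot a.1 a.2.2 :=
    Φ.computable_snapshot.comp Computable.fst (Computable.snd.comp Computable.snd)
  have hT := (PrimrecPred.decide (PrimrecRel.forall_mem_list hE)).to_comp.comp
    ((M.computable_guardTable Φ).pair (hsnap.pair
      (Computable.list_length.comp (Computable.fst.comp Computable.snd))))
  refine (Primrec.and.to_comp.comp (M.computable_isDone Φ) hT).of_eq fun a => ?_
  exact (Bool.decide_and _ _).symm

theorem IsCovered.mono {c n : ℕ} {q : List Bool} {s t : ℕ} (hst : s ≤ t)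
    (h : M.IsCovered Φ c n q s) : M.IsCovered Φ c n q t := by
  refine ⟨h.1.mono hst, fun e he => ?_⟩
  rw [(h.1.mono hst).guardTable_eq h.1] at he
  obtain ⟨u, hu, h1, h2⟩ := h.2 e he
  rw [Interpreter.mem_snapshot] at hu
  exact ⟨u, Interpreter.mem_snapshot.2 (Φ.mono_step _ _ _ _ _ hst hu), h1, h2⟩

/-- Only finitely many computations have to halt, and halting is permanent. -/
theorem Computes.exists_isCovered {c n : ℕ} {q : List Bool} {out : List Bool → List ℕ}
    (hq : M.Computes Φ n q out) (hc : ∀ e ∈ M.codeTable n out,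
      ∃ p : List Bool, p.length ≤ q.length + e.1.length + c ∧ Φ.Outputs p [n] [e.2]) :
    ∃ t, M.IsCovered Φ c n q t := by
  have : ∀ᶠ t in Filter.atTop, ∀ e ∈ (M.codeTable n out).toFinset,
      ∃ s ∈ Φ.snapshot n t, s.1.length ≤ q.length + e.1.length + c ∧ s.2 = [e.2] := by
    rw [Filter.eventually_all_finset]
    intro e he
    obtain ⟨p, hp, s, hs⟩ := hc e (List.mem_toFinset.1 he)
    filter_upwards [Filter.eventually_ge_atTop s] with t ht
    exact ⟨(p, [e.2]), Interpreter.mem_snapshot.2 (Φ.mono_step _ _ _ _ _ ht hs), hp, rfl⟩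
  obtain ⟨t, h1, h2⟩ := (this.and hq.eventually_isDone).exists
  refine ⟨t, h2, fun e he => h1 e (List.mem_toFinset.2 ?_)⟩
  rwa [hq.results_eq h2] at he

theorem IsCovered.stageK_le {c n : ℕ} {q w : List Bool} {out : List Bool → List ℕ} {t : ℕ}
    {x : List Bool} (h : M.IsCovered Φ c n q t) (hq : M.Computes Φ n q out)
    (hw : (w, strCode x) ∈ M.codeTable n out) :
    Φ.stageK n t x ≤ ((q.length + w.length + c : ℕ) : ℕ∞) := by
  rw [codeTable, ← hq.results_eq h.1] at hw
  obtain ⟨s, hs, h1, h2⟩ := h.2 _ hw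
  rw [Interpreter.mem_snapshot, h2] at hs
  exact minLength_le_iff.2 ⟨s.1, hs, h1⟩

/-- From a program for a model, `k` and two bits one can compute `Ω^{n,k}` if the time within which
all two-part descriptions have been found is large enough. -/
theorem exists_computesWithin_omegaBits (M : ModelKind) (hpf : Φ.PrefixFree) (hopt : Φ.Optimal)
    (c : ℕ) : ∃ C : ℕ, ∀ n q k, (∃ t, M.IsCovered Φ c n q t) →
      (∀ t, M.IsCovered Φ c n q t → 0 < k → Φ.omegaTime n (k - 1) ≤ t) →
      Φ.ComputesWithin n C [strCode q, k] [strCode (Φ.omegaBits n k)] := by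
  -- Requiring two program bits makes the domain prefix-free. The last clause singles out the least
  -- covering time, so the output does not depend on the witness found.
  let Cond : (List Bool × List ℕ) × List Bool × ℕ → Prop := fun a =>
    (a.1.1.length = 2 ∧ strCode a.2.1 = a.1.2.getI 0) ∧
      M.IsCovered Φ c (a.1.2.getI 2) a.2.1 a.2.2 ∧
      (a.2.2 = 0 ∨ ¬ M.IsCovered Φ c (a.1.2.getI 2) a.2.1 (a.2.2 - 1))
  let val : (List Bool × List ℕ) × List Bool × ℕ → ℕ := fun a =>
    2 ^ a.1.2.getI 1 * Φ.omegaNum (a.1.2.getI 2) a.2.2 / 2 ^ a.2.2 + (strCode a.1.1 - 3)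
  let B : List Bool × List ℕ → List Bool × ℕ → Option (List ℕ) := fun a w =>
    if Cond (a, w) then some [strCode (bitsOf (a.2.getI 1) (val (a, w)))] else none
  have hget : ∀ i : ℕ, Primrec fun a : (List Bool × List ℕ) × List Bool × ℕ => a.1.2.getI i :=
    fun i => Primrec.list_getI.comp (Primrec.snd.comp Primrec.fst) (Primrec.const i)
  have ht : Primrec fun a : (List Bool × List ℕ) × List Bool × ℕ => a.2.2 :=
    Primrec.snd.comp Primrec.snd
  have hqp : Primrec fun a : (List Bool × List ℕ) × List Bool × ℕ => a.2.1 :=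
    Primrec.fst.comp Primrec.snd
  have hp : Primrec fun a : (List Bool × List ℕ) × List Bool × ℕ => a.1.1 :=
    Primrec.fst.comp Primrec.fst
  have hB : Computable₂ B := by
    refine Computable.ite (c := Cond) ?_ ?_ (Computable.const none)
    · have h1 := (PrimrecPred.decide (PrimrecPred.and
        (Primrec.eq.comp (Primrec.list_length.comp hp) (Primrec.const 2))
        (Primrec.eq.comp (primrec_strCode.comp hqp) (hget 0)))).to_comp
      have h2 := (M.computable_isCovered Φ c).comp
        ((hget 2).to_comp.pair (hqp.to_comp.pair ht.to_comp))
      have h3 := (M.computable_isCovered Φ c).comp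
        ((hget 2).to_comp.pair (hqp.to_comp.pair (Primrec.pred.comp ht).to_comp))
      have h4 := (PrimrecPred.decide (Primrec.eq.comp ht (Primrec.const 0))).to_comp
      refine (Primrec.and.to_comp.comp h1 (Primrec.and.to_comp.comp h2
        (Primrec.or.to_comp.comp h4 (Primrec.not.to_comp.comp h3)))).of_eq fun a => ?_
      simp [Cond]
    · refine Computable.option_some.comp (Computable.list_cons.comp
        (primrec_strCode.to_comp.comp (primrec_bitsOf.to_comp.comp (hget 1).to_comp ?_))
        (Computable.const []))
      refine Primrec.nat_add.to_comp.comp (Primrec.nat_div.to_comp.comp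
        (Primrec.nat_mul.to_comp.comp (Primrec.nat_pow (Primrec.const 2) (hget 1)).to_comp
          (Φ.computable_omegaNum.comp (hget 2).to_comp ht.to_comp))
        (Primrec.nat_pow (Primrec.const 2) ht).to_comp) ?_
      exact (Primrec.nat_sub.comp (primrec_strCode.comp hp) (Primrec.const 3)).to_comp
  obtain ⟨C, hC⟩ := hopt.exists_search hB (by
    intro y p p' w w' z z' h h' hpp
    refine hpp.eq_of_length ?_
    dsimp only [B] at h h'
    split_ifs at h h' with h1 h2
    exact h1.1.1.trans h2.1.1.symm)
  refine ⟨2 + C, fun n q k hex htime => ?_⟩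
  classical
  set t := Nat.find hex with htdef
  have hcov : M.IsCovered Φ c n q t := Nat.find_spec hex
  obtain ⟨a, ha, hbits⟩ := hpf.exists_omegaBits_eq (htime t hcov)
  -- The strings 00, 01, 10 have the codes 3, 4, 5.
  obtain ⟨p, hp2, hpa⟩ : ∃ p : List Bool, p.length = 2 ∧ strCode p - 3 = a := by
    interval_cases a
    · exact ⟨[false, false], rfl, rfl⟩
    · exact ⟨[false, true], rfl, rfl⟩
    · exact ⟨[true, false], rfl, rfl⟩
  have hmin : t = 0 ∨ ¬ M.IsCovered Φ c n q (t - 1) := by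
    rcases Nat.eq_zero_or_pos t with h | h
    · exact Or.inl h
    · exact Or.inr (Nat.find_min hex (by omega))
  have hcond : Cond ((p, [strCode q, k, n]), (q, t)) := ⟨⟨hp2, rfl⟩, hcov, hmin⟩
  obtain ⟨r, ⟨q', t'⟩, z, hr, hw, hout⟩ := hC p [strCode q, k, n] ⟨(q, t), _, if_pos hcond⟩
  refine ⟨r, by omega, ?_⟩
  dsimp only [B] at hw
  split_ifs at hw with hc'
  obtain ⟨⟨-, hq'⟩, hcov', hmin'⟩ := hc'
  obtain rfl : q' = q := strCode_injective hq'
  change M.IsCovered Φ c n q' t' at hcov'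
  change t' = 0 ∨ ¬ M.IsCovered Φ c n q' (t' - 1) at hmin'
  have htt : t' = t := by
    refine le_antisymm ?_ (Nat.find_min' hex hcov')
    by_contra hlt
    rcases hmin' with h | h
    · omega
    · exact h (hcov.mono (by omega))
  rw [htt] at hw
  simp only [Option.some.injEq] at hw
  subst hw
  have hv : val ((p, [strCode q', k, n]), (q', t)) =
      2 ^ k * Φ.omegaNum n t / 2 ^ t + a := by rw [← hpa]; rfl
  rw [hv] at hout
  rw [hbits]
  exact hout

end ModelKind

/-! ### Fresh strings and the lower bound for model programs -/

/-- A string of length `n` that is not the output of any of the listed programs of length less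
than `n`. -/
def freshStr (n : ℕ) (L : List (List Bool × List ℕ)) : Option (List Bool) :=
  ((allStrs n).filter fun x => decide (∀ s ∈ L, n ≤ s.1.length ∨ s.2 ≠ [strCode x])).head?

theorem primrec_freshStr : Primrec₂ freshStr := by
  have h1 : PrimrecRel fun (s : List Bool × List ℕ) (b : ℕ × List Bool) =>
      b.1 ≤ s.1.length ∨ s.2 ≠ [strCode b.2] := by
    refine PrimrecPred.or (Primrec.nat_le.comp (Primrec.fst.comp Primrec.snd)
      (Primrec.list_length.comp (Primrec.fst.comp Primrec.fst))) (PrimrecPred.not ?_)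
    exact Primrec.eq.comp (Primrec.snd.comp Primrec.fst) (Primrec.list_cons.comp
      (primrec_strCode.comp (Primrec.snd.comp Primrec.snd)) (Primrec.const []))
  have h2 : PrimrecRel fun (x : List Bool) (b : ℕ × List (List Bool × List ℕ)) =>
      ∀ s ∈ b.2, b.1 ≤ s.1.length ∨ s.2 ≠ [strCode x] :=
    (PrimrecRel.forall_mem_list h1).comp (Primrec.snd.comp Primrec.snd)
      ((Primrec.fst.comp Primrec.snd).pair Primrec.fst)
  exact Primrec.list_head?.comp ((PrimrecRel.listFilter h2).comp
    (primrec_allStrs.comp Primrec.fst) Primrec.id)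

theorem freshStr_spec {n : ℕ} {L : List (List Bool × List ℕ)} {x : List Bool}
    (h : freshStr n L = some x) :
    x.length = n ∧ ∀ s ∈ L, n ≤ s.1.length ∨ s.2 ≠ [strCode x] := by
  have := List.mem_of_mem_head? (Option.mem_def.2 h)
  simpa [List.mem_filter, mem_allStrs] using this

namespace Interpreter

variable {Φ : Interpreter}

/-- There are `2^n` strings of length `n` but only `2^n - 1` programs shorter than `n`. -/
theorem exists_freshStr (Φ : Interpreter) (n t : ℕ) :
    ∃ x, freshStr n (Φ.snapshot n t) = some x := by
  by_contra hno
  have hall : ∀ x ∈ allStrs n, ∃ p : List Bool, p.length < n ∧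
      Φ.step t p [n] = some [strCode x] := by
    intro x hx
    by_contra hp
    refine hno ?_
    have hx' : x ∈ (allStrs n).filter fun x =>
        decide (∀ s ∈ Φ.snapshot n t, n ≤ s.1.length ∨ s.2 ≠ [strCode x]) := by
      refine List.mem_filter.2 ⟨hx, decide_eq_true fun s hs => ?_⟩
      by_contra hs'
      push Not at hs'
      exact hp ⟨s.1, hs'.1, by rw [mem_snapshot.1 hs, hs'.2]⟩
    exact Option.isSome_iff_exists.1 (by
      rw [freshStr, List.isSome_head?]
      exact fun h => (List.ne_nil_of_mem hx') h)
  choose! f hf using hall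
  cases n with
  | zero => exact absurd (hf [] (by simp [allStrs])).1 (by omega)
  | succ m =>
    have hcard := Finset.card_le_card_of_injOn (s := (allStrs (m + 1)).toFinset)
      (t := (strsUpTo m).toFinset) f
      (fun x hx => by
        have := (hf x (List.mem_toFinset.1 hx)).1
        exact List.mem_toFinset.2 (mem_strsUpTo.2 (by omega)))
      (fun x hx y hy hxy => by
        have h1 := (hf x (List.mem_toFinset.1 hx)).2
        have h2 := (hf y (List.mem_toFinset.1 hy)).2
        rw [hxy, h2] at h1
        simp only [Option.some.injEq, List.cons.injEq, and_true] at h1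
        exact (strCode_injective h1).symm)
    rw [List.toFinset_card_of_nodup (nodup_allStrs _),
      List.toFinset_card_of_nodup (nodup_strsUpTo _), length_allStrs] at hcard
    have := length_strsUpTo m
    omega

end Interpreter

namespace ModelKind

variable {Φ : Interpreter}

/-- Programs for models whose two-part descriptions take long to be found are long. -/
theorem exists_min_le_length (M : ModelKind) (hpf : Φ.PrefixFree) (hopt : Φ.Optimal) (c : ℕ) :
    ∃ C : ℕ, ∀ n q k, (∃ t, M.IsCovered Φ c n q t) →
      (∀ t, M.IsCovered Φ c n q t → Φ.omegaTime n k ≤ t) → min n k ≤ q.length + C := by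
  let B : List Bool × List ℕ → ℕ → Option (List ℕ) := fun a t =>
    if M.IsCovered Φ c a.2.headI a.1 t then
      (freshStr a.2.headI (Φ.snapshot a.2.headI t)).map fun x => [strCode x] else none
  have hn : Computable fun a : (List Bool × List ℕ) × ℕ => a.1.2.headI :=
    (Primrec.list_headI.comp (Primrec.snd.comp Primrec.fst)).to_comp
  have hB : Computable₂ B := by
    refine Computable.ite (c := fun a : (List Bool × List ℕ) × ℕ =>
      M.IsCovered Φ c a.1.2.headI a.1.1 a.2) ?_ ?_ (Computable.const none)
    · have h := Computable.comp (M.computable_isCovered Φ c)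
        (hn.pair ((Computable.fst.comp Computable.fst).pair Computable.snd))
      exact h.of_eq fun a => rfl
    · refine Computable.option_map (primrec_freshStr.to_comp.comp hn
        (Φ.computable_snapshot.comp hn Computable.snd)) ?_
      exact Computable.list_cons.comp (primrec_strCode.to_comp.comp Computable.snd)
        (Computable.const [])
  -- The machine's program is `q` itself, so its domain inherits prefix-freeness from `Φ`.
  obtain ⟨C, hC⟩ := hopt.exists_search hB (by
    intro y p p' w w' z z' h h' hpp
    dsimp only [B] at h h'
    split_ifs at h h' with h1 h2
    exact h1.1.eq_of_prefix hpf h2.1 hpp)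
  refine ⟨C, fun n q k ⟨t, ht⟩ htime => ?_⟩
  obtain ⟨x₀, hx₀⟩ := Φ.exists_freshStr n t
  have hval : B (q, [n]) t = some [strCode x₀] := by
    simp only [B, List.headI_cons, if_pos ht, hx₀, Option.map_some]
  obtain ⟨p, t', z, hp, hw, hout⟩ := hC q [n] ⟨t, _, hval⟩
  dsimp only [B] at hw
  split_ifs at hw with hcov
  dsimp only [List.headI_cons] at hcov hw
  obtain ⟨x, hx, rfl⟩ := Option.map_eq_some_iff.1 hw
  obtain ⟨hlen, hfresh⟩ := freshStr_spec hx
  refine le_trans ?_ hp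
  by_contra hlt
  obtain ⟨hpn, hpk⟩ := lt_min_iff.1 (not_le.1 hlt)
  subst hlen
  -- A program this short would have halted by the covering time and thus be in the snapshot that
  -- `x` was chosen to avoid.
  have hstep := hpf.step_of_omegaTime_le hout (htime t' hcov) hpk
  rcases hfresh (p, [strCode x]) (Interpreter.mem_snapshot.2 hstep) with h | h
  · exact absurd h (by simpa using hpn)
  · exact h rfl

/-- Programs for models with a short two-part description of `x` compute `Ω^{n,k}`, where `k` is
the m-depth of `x`, and their length is at least `k` up to a constant. -/
theorem exists_depth_bounds (M : ModelKind) (hpf : Φ.PrefixFree) (hopt : Φ.Optimal) (e : ℕ) :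
    ∃ d₀ : ℕ, ∀ d : ℕ, d₀ ≤ d → ∃ C : ℕ, ∀ (x q w : List Bool) (out : List Bool → List ℕ),
      M.Computes Φ x.length q out → (w, strCode x) ∈ M.codeTable x.length out →
      ((q.length + w.length : ℕ) : ℕ∞) ≤ Φ.K x.length x + e →
      Φ.ComputesWithin x.length C [strCode q, Φ.mDepth d x]
        [strCode (Φ.omegaBits x.length (Φ.mDepth d x))] ∧
      Φ.mDepth d x ≤ q.length + C := by
  obtain ⟨c, hc⟩ := M.exists_two_part hpf hopt
  obtain ⟨c₁, hc₁⟩ := hopt.exists_K_le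
  obtain ⟨C₁, hC₁⟩ := M.exists_computesWithin_omegaBits hpf hopt c
  obtain ⟨C₂, hC₂⟩ := M.exists_min_le_length hpf hopt c
  -- In `d₀`, the slack `e` is that of the given two-part description and `c` is the cost of
  -- decoding it.
  refine ⟨e + c, fun d hd => ⟨C₁ + C₂ + c₁ + 1, fun x q w out hq hw hlen => ?_⟩⟩
  have hex := hq.exists_isCovered (hc _ _ _ hq)
  have hK : ∀ t, M.IsCovered Φ c x.length q t →
      Φ.stageK x.length t x ≤ Φ.K x.length x + d := by
    intro t ht
    calc Φ.stageK x.length t x ≤ ((q.length + w.length + c : ℕ) : ℕ∞) := ht.stageK_le hq hw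
      _ = ((q.length + w.length : ℕ) : ℕ∞) + c := by push_cast; rfl
      _ ≤ Φ.K x.length x + e + c := by gcongr
      _ = Φ.K x.length x + ((e + c : ℕ) : ℕ∞) := by push_cast; rw [add_assoc]
      _ ≤ Φ.K x.length x + d := by gcongr
  have htime : ∀ t, M.IsCovered Φ c x.length q t → 0 < Φ.mDepth d x →
      Φ.omegaTime x.length (Φ.mDepth d x - 1) ≤ t := fun t ht h0 =>
    (Interpreter.omegaTime_lt_of_stageK_le (by omega) (hK t ht)).le
  constructor
  · obtain ⟨p, hp, hout⟩ := hC₁ x.length q (Φ.mDepth d x) hex htime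
    exact ⟨p, by omega, hout⟩
  · have h1 := hpf.mDepth_le (d := d) (hc₁ x)
    rcases Nat.eq_zero_or_pos (Φ.mDepth d x) with h0 | h0
    · omega
    · have h2 := hC₂ x.length q (Φ.mDepth d x - 1) hex fun t ht => htime t ht h0
      -- If the minimum is the length of `x`, the bound `h1` of the m-depth by that length takes
      -- over.
      rcases min_le_iff.1 h2 with h | h <;> omega

end ModelKind

/-! ### Arithmetic codes -/

/-- The greatest `j` with `2^(j+1) ≤ v` (for `2 ≤ v`). -/
def blockLog (v : ℕ) : ℕ := Nat.findGreatest (fun j => 2 ^ (j + 1) ≤ v) v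

theorem le_blockLog {j v : ℕ} (h : 2 ^ (j + 1) ≤ v) : j ≤ blockLog v :=
  Nat.le_findGreatest ((Nat.lt_two_pow_self.trans (Nat.pow_lt_pow_succ (by norm_num))).le.trans h) h

theorem two_pow_blockLog_le {v : ℕ} (h : 2 ≤ v) : 2 ^ (blockLog v + 1) ≤ v :=
  Nat.findGreatest_spec (P := fun j => 2 ^ (j + 1) ≤ v) (Nat.zero_le v) (by simpa using h)

theorem primrec_blockLog : Primrec blockLog :=
  Primrec.nat_findGreatest Primrec.id (Primrec.nat_le.comp
    (Primrec.nat_pow (Primrec.const 2) (Primrec.succ.comp Primrec.snd)) Primrec.fst)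

/-- The size `2^m·a/(b+1)` of the interval assigned to the request `(z, a, b)`. -/
def requestSize (m : ℕ) (r : ℕ × ℕ × ℕ) : ℕ := r.2.1 * 2 ^ m / (r.2.2 + 1)

/-- Adds to the table a codeword for a dyadic block inside the next free interval. -/
def arithStep (m : ℕ) (s : ℕ × List (List Bool × ℕ)) (r : ℕ × ℕ × ℕ) :
    ℕ × List (List Bool × ℕ) :=
  (s.1 + requestSize m r,
    if 2 ≤ requestSize m r then
      (bitsOf (m + 1 - blockLog (requestSize m r))
        ((s.1 + 2 ^ blockLog (requestSize m r) - 1) / 2 ^ blockLog (requestSize m r)), r.1) :: s.2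
    else s.2)

/-- A code for the requests `(z, a, b)` in `l`, meaning that the number `z` is to have a codeword
of length about `-log (a/(b+1))`. -/
def arithTable (m : ℕ) (l : List (ℕ × ℕ × ℕ)) : List (List Bool × ℕ) :=
  (l.foldl (arithStep m) (0, [])).2

theorem primrec_arithTable : Primrec₂ arithTable := by
  have hv : Primrec fun b : (ℕ × List (ℕ × ℕ × ℕ)) × (ℕ × List (List Bool × ℕ)) × ℕ × ℕ × ℕ =>
      requestSize b.1.1 b.2.2 := by
    refine Primrec.nat_div.comp (Primrec.nat_mul.comp ?_ (Primrec.nat_pow (Primrec.const 2)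
      (Primrec.fst.comp Primrec.fst))) (Primrec.succ.comp ?_)
    · exact Primrec.fst.comp (Primrec.snd.comp (Primrec.snd.comp Primrec.snd))
    · exact Primrec.snd.comp (Primrec.snd.comp (Primrec.snd.comp Primrec.snd))
  have hs : Primrec fun b : (ℕ × List (ℕ × ℕ × ℕ)) × (ℕ × List (List Bool × ℕ)) × ℕ × ℕ × ℕ =>
      b.2.1 := Primrec.fst.comp Primrec.snd
  have hj := primrec_blockLog.comp hv
  have hp := Primrec.nat_pow (Primrec.const 2) hj
  have hw := primrec_bitsOf.comp
    (Primrec.nat_sub.comp (Primrec.succ.comp (Primrec.fst.comp Primrec.fst)) hj)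
    (Primrec.nat_div.comp (Primrec.nat_sub.comp (Primrec.nat_add.comp (Primrec.fst.comp hs) hp)
      (Primrec.const 1)) hp)
  have hcons := Primrec.list_cons.comp
    (hw.pair (Primrec.fst.comp (Primrec.snd.comp Primrec.snd))) (Primrec.snd.comp hs)
  have hstep : Primrec fun b : (ℕ × List (ℕ × ℕ × ℕ)) × (ℕ × List (List Bool × ℕ)) × ℕ × ℕ × ℕ =>
      arithStep b.1.1 b.2.1 b.2.2 :=
    (Primrec.nat_add.comp (Primrec.fst.comp hs) hv).pair
      (Primrec.ite (Primrec.nat_le.comp (Primrec.const 2) hv) hcons (Primrec.snd.comp hs))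
  exact Primrec.snd.comp (Primrec.list_foldl (f := fun a : ℕ × List (ℕ × ℕ × ℕ) => a.2)
    (g := fun _ => ((0 : ℕ), ([] : List (List Bool × ℕ))))
    (h := fun a b => arithStep a.1 b.1 b.2) Primrec.snd (Primrec.const _) hstep)

/-- The codewords of the table are prefix-free and belong to dyadic blocks below `s`. -/
def IsArithState (m : ℕ) (s : ℕ × List (List Bool × ℕ)) : Prop :=
  PrefixFreeTable s.2 ∧ ∀ e ∈ s.2, ∃ j u, j ≤ m + 1 ∧ e.1 = bitsOf (m + 1 - j) u ∧
    (u + 1) * 2 ^ j ≤ s.1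

/-- The codeword `bitsOf (m + 1 - j) u` stands for the dyadic block `[u 2^j, (u+1) 2^j)` inside `[0,
2^(m+1))`. A prefix relation between codewords would be an inclusion of blocks, which is impossible
when one block ends before the other begins. -/
theorem not_prefix_of_blocks {m j u j' u' : ℕ} (hj : j ≤ m + 1) (hj' : j' ≤ m + 1)
    (h : (u' + 1) * 2 ^ j' ≤ u * 2 ^ j) (hu : (u + 1) * 2 ^ j ≤ 2 ^ (m + 1)) :
    ¬ bitsOf (m + 1 - j) u <+: bitsOf (m + 1 - j') u' ∧
      ¬ bitsOf (m + 1 - j') u' <+: bitsOf (m + 1 - j) u := by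
  have hlt : ∀ i v, i ≤ m + 1 → (v + 1) * 2 ^ i ≤ 2 ^ (m + 1) → v < 2 ^ (m + 1 - i) := by
    intro i v hi hv
    have : 2 ^ (m + 1) = 2 ^ (m + 1 - i) * 2 ^ i := by rw [← pow_add, Nat.sub_add_cancel hi]
    rw [this] at hv
    exact Nat.le_of_mul_le_mul_right hv (by positivity)
  have h1 := hlt j u hj hu
  have h2 := hlt j' u' hj' (h.trans ((Nat.mul_le_mul_right _ (Nat.le_succ u)).trans hu))
  constructor
  · intro hp
    obtain ⟨hle, heq⟩ := eq_div_of_bitsOf_prefix h1 h2 hp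
    rw [show m + 1 - j' - (m + 1 - j) = j - j' by omega] at heq
    have h3 : u * 2 ^ (j - j') ≤ u' := by rw [heq]; exact Nat.div_mul_le_self _ _
    have h4 : u * 2 ^ j ≤ u' * 2 ^ j' := by
      calc u * 2 ^ j = u * 2 ^ (j - j') * 2 ^ j' := by
            rw [mul_assoc, ← pow_add, Nat.sub_add_cancel (by omega)]
        _ ≤ u' * 2 ^ j' := Nat.mul_le_mul_right _ h3
    have h5 : u' * 2 ^ j' < (u' + 1) * 2 ^ j' :=
      Nat.mul_lt_mul_of_pos_right (Nat.lt_succ_self _) (by positivity)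
    omega
  · intro hp
    obtain ⟨hle, heq⟩ := eq_div_of_bitsOf_prefix h2 h1 hp
    rw [show m + 1 - j - (m + 1 - j') = j' - j by omega] at heq
    have h3 : u < (u' + 1) * 2 ^ (j' - j) := by
      rw [heq]
      exact Nat.lt_mul_of_div_lt (Nat.lt_succ_self _) (by positivity)
    have h4 : u * 2 ^ j < (u' + 1) * 2 ^ j' := by
      calc u * 2 ^ j < (u' + 1) * 2 ^ (j' - j) * 2 ^ j :=
            Nat.mul_lt_mul_of_pos_right h3 (by positivity)
        _ = (u' + 1) * 2 ^ j' := by rw [mul_assoc, ← pow_add, Nat.sub_add_cancel (by omega)]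
    omega

theorem IsArithState.step {m : ℕ} {s : ℕ × List (List Bool × ℕ)} (hs : IsArithState m s)
    {r : ℕ × ℕ × ℕ} (hr : s.1 + requestSize m r ≤ 2 ^ (m + 1)) :
    IsArithState m (arithStep m s r) := by
  unfold arithStep
  generalize requestSize m r = v at hr ⊢
  have hold : ∀ e ∈ s.2, ∃ j u, j ≤ m + 1 ∧ e.1 = bitsOf (m + 1 - j) u ∧
      (u + 1) * 2 ^ j ≤ s.1 + v := fun e he => by
    obtain ⟨j, u, h1, h2, h3⟩ := hs.2 e he
    exact ⟨j, u, h1, h2, by omega⟩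
  split_ifs with hv
  · have hj := two_pow_blockLog_le hv
    generalize blockLog v = j at hj ⊢
    have hpos : 0 < 2 ^ j := by positivity
    -- Rounding the left end up to a multiple of `2^j` wastes less than `2^j`; as the interval has
    -- length at least `2^(j+1)`, a whole block still fits.
    set u := (s.1 + 2 ^ j - 1) / 2 ^ j with hu
    have hlow : s.1 ≤ u * 2 ^ j := by
      have h1 := Nat.div_add_mod (s.1 + 2 ^ j - 1) (2 ^ j)
      have h2 := Nat.mod_lt (s.1 + 2 ^ j - 1) hpos
      rw [← hu, mul_comm] at h1
      omega
    have hup : (u + 1) * 2 ^ j ≤ s.1 + v := by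
      have h1 := Nat.div_mul_le_self (s.1 + 2 ^ j - 1) (2 ^ j)
      rw [← hu] at h1
      rw [pow_succ] at hj
      rw [add_mul]
      omega
    have hjm : j ≤ m + 1 := by
      rw [← Nat.pow_le_pow_iff_right (show 1 < 2 by norm_num)]
      exact (Nat.le_mul_of_pos_left _ (Nat.succ_pos u)).trans (hup.trans hr)
    have hnew : ∀ e ∈ s.2, ¬ bitsOf (m + 1 - j) u <+: e.1 ∧ ¬ e.1 <+: bitsOf (m + 1 - j) u := by
      intro e he
      obtain ⟨j', u', h1, h2, h3⟩ := hs.2 e he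
      rw [h2]
      exact not_prefix_of_blocks hjm h1 (h3.trans hlow) (hup.trans hr)
    refine ⟨?_, ?_⟩
    · intro e he e' he' hee
      rcases List.mem_cons.1 he with rfl | he <;> rcases List.mem_cons.1 he' with rfl | he'
      · rfl
      · exact absurd hee (hnew e' he').1
      · exact absurd hee (hnew e he).2
      · exact hs.1 e he e' he' hee
    · intro e he
      rcases List.mem_cons.1 he with rfl | he
      · exact ⟨j, u, hjm, rfl, hup⟩
      · exact hold e he
  · exact ⟨hs.1, hold⟩

theorem prefixFreeTable_arithTable {m : ℕ} {l : List (ℕ × ℕ × ℕ)}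
    (h : (l.map (requestSize m)).sum ≤ 2 ^ (m + 1)) : PrefixFreeTable (arithTable m l) := by
  have aux : ∀ (l : List (ℕ × ℕ × ℕ)) (s : ℕ × List (List Bool × ℕ)), IsArithState m s →
      s.1 + (l.map (requestSize m)).sum ≤ 2 ^ (m + 1) →
      IsArithState m (l.foldl (arithStep m) s) := by
    intro l
    induction l with
    | nil => intro s hs _; exact hs
    | cons r l ih =>
      intro s hs hsum
      rw [List.map_cons, List.sum_cons, ← add_assoc] at hsum
      exact ih _ (hs.step (by omega)) hsum
  exact (aux l (0, []) ⟨by simp [PrefixFreeTable], by simp⟩ (by simpa using h)).1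

/-- Weight at least `2^-ℓ` gives an interval of size at least `2^(m-ℓ)`, hence a block of size at
least `2^(m-ℓ-1)` and a codeword of at most `m + 1 - (m - ℓ - 1) = ℓ + 2` bits. -/
theorem exists_mem_arithTable {m ℓ : ℕ} {l : List (ℕ × ℕ × ℕ)} {z a b : ℕ}
    (hmem : (z, a, b) ∈ l) (hab : b + 1 ≤ a * 2 ^ ℓ) (hℓ : ℓ + 1 ≤ m) :
    ∃ w : List Bool, (w, z) ∈ arithTable m l ∧ w.length ≤ ℓ + 2 := by
  have hsize : 2 ^ (m - ℓ - 1 + 1) ≤ requestSize m (z, a, b) := by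
    rw [requestSize, Nat.le_div_iff_mul_le (by positivity)]
    calc 2 ^ (m - ℓ - 1 + 1) * (b + 1) ≤ 2 ^ (m - ℓ - 1 + 1) * (a * 2 ^ ℓ) :=
          Nat.mul_le_mul_left _ hab
      _ = a * 2 ^ m := by
          rw [mul_left_comm, ← pow_add, show m - ℓ - 1 + 1 + ℓ = m by omega]
  have hkeep : ∀ (l : List (ℕ × ℕ × ℕ)) (s : ℕ × List (List Bool × ℕ)), ∀ e ∈ s.2,
      e ∈ (l.foldl (arithStep m) s).2 := by
    intro l
    induction l with
    | nil => intro s e he; exact he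
    | cons r l ih =>
      intro s e he
      refine ih _ e ?_
      unfold arithStep
      split_ifs
      · exact List.mem_cons_of_mem _ he
      · exact he
  obtain ⟨l₁, l₂, rfl⟩ := List.append_of_mem hmem
  rw [arithTable, List.foldl_append, List.foldl_cons]
  generalize l₁.foldl (arithStep m) (0, []) = s
  refine ⟨bitsOf (m + 1 - blockLog (requestSize m (z, a, b)))
    ((s.1 + 2 ^ blockLog (requestSize m (z, a, b)) - 1) / 2 ^ blockLog (requestSize m (z, a, b))),
    hkeep l₂ _ _ ?_, ?_⟩
  · have h2 : 2 ≤ requestSize m (z, a, b) :=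
      le_trans (by rw [pow_succ]; have := Nat.one_le_two_pow (n := m - ℓ - 1); omega) hsize
    simp [arithStep, h2]
  · have := le_blockLog hsize
    rw [length_bitsOf]
    omega

/-! ### Set statistics -/

theorem Primrec.list_dedup : Primrec (List.dedup : List ℕ → List ℕ) := by
  have hmem : PrimrecRel fun (l : List ℕ) (a : ℕ) => ∃ b ∈ l, b = a :=
    PrimrecRel.exists_mem_list Primrec.eq
  have h : Primrec fun l : List ℕ =>
      l.foldr (fun a s => if ∃ b ∈ s, b = a then s else a :: s) [] :=
    Primrec.list_foldr (h := fun _ (p : ℕ × List ℕ) => if ∃ b ∈ p.2, b = p.1 then p.2 else p.1 :: p.2)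
      Primrec.id (Primrec.const [])
      (Primrec.ite (hmem.comp (Primrec.snd.comp Primrec.snd) (Primrec.fst.comp Primrec.snd))
        (Primrec.snd.comp Primrec.snd)
        (Primrec.list_cons.comp (Primrec.fst.comp Primrec.snd) (Primrec.snd.comp Primrec.snd)))
  refine h.of_eq fun l => ?_
  induction l with
  | nil => rfl
  | cons a l ih =>
    rw [List.foldr_cons, ih]
    by_cases ha : a ∈ l
    · rw [List.dedup_cons_of_mem ha, if_pos ⟨a, List.mem_dedup.2 ha, rfl⟩]
    · rw [List.dedup_cons_of_notMem ha, if_neg]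
      rintro ⟨b, hb, rfl⟩
      exact ha (List.mem_dedup.1 hb)

/-- Equal weights for the different numbers in a list. -/
def uniformRequests (w : List ℕ) : List (ℕ × ℕ × ℕ) :=
  w.dedup.map fun z => (z, 1, w.dedup.length - 1)

theorem primrec_uniformRequests : Primrec uniformRequests :=
  Primrec.list_map Primrec.list_dedup (Primrec.snd.pair ((Primrec.const 1).pair
    (Primrec.pred.comp (Primrec.list_length.comp (Primrec.list_dedup.comp Primrec.fst)))))

/-- Finite sets: a single output enumerates all elements. -/
def setKind : ModelKind where
  labels _ := [[]]
  input n _ := [n]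
  table _ res := arithTable ((res.flatMap Prod.snd).dedup.length + 1)
    (uniformRequests (res.flatMap Prod.snd))
  computable_labels := Computable.const _
  computable_input := (Primrec.list_cons.comp Primrec.fst (Primrec.const [])).to_comp
  computable_table := by
    have h : Primrec fun a : ℕ × List (List Bool × List ℕ) => a.2.flatMap Prod.snd :=
      Primrec.list_flatMap Primrec.snd (Primrec.snd.comp Primrec.snd)
    exact (primrec_arithTable.comp (Primrec.succ.comp (Primrec.list_length.comp
      (Primrec.list_dedup.comp h))) (primrec_uniformRequests.comp h)).to_comp
  labels_ne_nil _ := by simp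

theorem exists_mem_codeTable_setKind {n : ℕ} {S : Finset (List Bool)} {x : List Bool}
    {w : List ℕ} (hx : x ∈ S) (hw : ∀ a, a ∈ w ↔ ∃ y ∈ S, strCode y = a) :
    ∃ v : List Bool, (v, strCode x) ∈ setKind.codeTable n (fun _ => w) ∧
      v.length ≤ Nat.clog 2 S.card + 2 := by
  classical
  have hcard : w.dedup.length = S.card := by
    rw [← List.toFinset_card_of_nodup (List.nodup_dedup w),
      ← Finset.card_image_of_injective S strCode_injective]
    congr 1
    ext a
    simp [hw]
  have hpos : 0 < S.card := Finset.card_pos.2 ⟨x, hx⟩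
  have htab : setKind.table n ((setKind.labels n).map fun y => (y, w)) =
      arithTable (S.card + 1) (uniformRequests w) := by
    simp [setKind, hcard]
  have hpf : PrefixFreeTable (arithTable (S.card + 1) (uniformRequests w)) := by
    refine prefixFreeTable_arithTable ?_
    have : (uniformRequests w).map (requestSize (S.card + 1)) =
        List.replicate S.card (2 ^ (S.card + 1) / S.card) := by
      refine List.eq_replicate_iff.2 ⟨by simp [uniformRequests, hcard], ?_⟩
      intro v hv
      simp only [uniformRequests, List.map_map, List.mem_map, Function.comp, requestSize, hcard,
        Nat.sub_add_cancel hpos, one_mul] at hv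
      obtain ⟨-, -, rfl⟩ := hv
      rfl
    rw [this, List.sum_replicate, smul_eq_mul]
    exact (Nat.mul_div_le _ _).trans (Nat.pow_le_pow_right (by norm_num) (by omega))
  rw [ModelKind.codeTable, htab, guardTable, if_pos hpf]
  refine exists_mem_arithTable (a := 1) (b := S.card - 1) ?_ ?_ ?_
  · rw [uniformRequests, hcard]
    exact List.mem_map.2 ⟨strCode x, List.mem_dedup.2 ((hw _).2 ⟨x, hx, rfl⟩), rfl⟩
  · rw [Nat.sub_add_cancel hpos, one_mul]
    exact Nat.le_pow_clog (by norm_num) _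
  -- The resolution `S.card + 1` is a crude choice that can be read off the output and suffices for
  -- codewords of length about `log |S|`.
  · have : Nat.clog 2 S.card ≤ S.card := Nat.clog_le_of_le_pow Nat.lt_two_pow_self.le
    omega

/-! ### Probabilistic statistics -/

/-- Semimeasures, evaluated on all strings of length `n` with precision `n + b`. -/
def probKind (b : ℕ) : ModelKind where
  labels := allStrs
  input n y := [strCode y, n + b, n]
  table n res := arithTable (n + b) (res.map fun r => (strCode r.1, r.2.getI 0, r.2.getI 1))
  computable_labels := primrec_allStrs.to_comp
  computable_input := (Primrec.list_cons.comp (primrec_strCode.comp Primrec.snd)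
    (Primrec.list_cons.comp (Primrec.nat_add.comp Primrec.fst (Primrec.const b))
      (Primrec.list_cons.comp Primrec.fst (Primrec.const [])))).to_comp
  computable_table := by
    have h : ∀ i : ℕ, Primrec fun a : (ℕ × List (List Bool × List ℕ)) × List Bool × List ℕ =>
        a.2.2.getI i := fun i =>
      Primrec.list_getI.comp (Primrec.snd.comp Primrec.snd) (Primrec.const i)
    refine (primrec_arithTable.comp (Primrec.nat_add.comp Primrec.fst (Primrec.const b))
      (Primrec.list_map Primrec.snd ?_)).to_comp
    exact (primrec_strCode.comp (Primrec.fst.comp Primrec.snd)).pair ((h 0).pair (h 1))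
  labels_ne_nil n := List.ne_nil_of_length_pos (by rw [length_allStrs]; positivity)

theorem sum_allStrs_eq (P : List Bool → ℝ) (n : ℕ) :
    ((allStrs n).map P).sum = ∑ y : Fin n → Bool, P (List.ofFn y) := by
  classical
  rw [← List.sum_toFinset P (nodup_allStrs n)]
  have : (allStrs n).toFinset = Finset.univ.image fun y : Fin n → Bool => List.ofFn y := by
    ext s
    simp only [List.mem_toFinset, mem_allStrs, Finset.mem_image, Finset.mem_univ, true_and]
    constructor
    · rintro rfl
      exact ⟨s.get, List.ofFn_get s⟩
    · rintro ⟨y, rfl⟩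
      simp
  rw [this, Finset.sum_image fun y _ y' _ h => List.ofFn_injective h]

theorem exists_mem_codeTable_probKind {b L : ℕ} {P : List Bool → ℝ} {x : List Bool}
    (hP : IsSemimeasure P) (hL : ((1 : ℝ) / 2) ^ L ≤ P x) (hLb : L + 2 ≤ x.length + b)
    {num den : List Bool → ℕ}
    (happrox : ∀ y, |(num y : ℝ) / (den y + 1) - P y| ≤ (1 / 2) ^ (x.length + b)) :
    ∃ v : List Bool, (v, strCode x) ∈
        (probKind b).codeTable x.length (fun y => [num y, den y]) ∧ v.length ≤ L + 3 := by
  set n := x.length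
  set m := n + b
  set l := (allStrs n).map fun y => (strCode y, num y, den y) with hl
  have htab : (probKind b).table n (((probKind b).labels n).map fun y => (y, [num y, den y])) =
      arithTable m l := by
    simp only [probKind, List.map_map, hl]
    rfl
  have hpf : PrefixFreeTable (arithTable m l) := by
    refine prefixFreeTable_arithTable ?_
    have hle : ((l.map (requestSize m)).sum : ℝ) ≤ 2 ^ (m + 1) := by
      calc ((l.map (requestSize m)).sum : ℝ)
          = ((allStrs n).map fun y => (requestSize m (strCode y, num y, den y) : ℝ)).sum := by
            rw [Nat.cast_list_sum, hl, List.map_map, List.map_map]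
            rfl
        _ ≤ ((allStrs n).map fun y => 2 ^ m * P y + 1).sum := by
            refine List.sum_le_sum fun y _ => ?_
            have h1 : (requestSize m (strCode y, num y, den y) : ℝ) ≤
                (num y : ℝ) * 2 ^ m / (den y + 1) := by
              have := Nat.cast_div_le (α := ℝ) (m := num y * 2 ^ m) (n := den y + 1)
              simpa [requestSize] using this
            have h2 := (abs_le.1 (happrox y)).2
            have h3 : (2 : ℝ) ^ m * (1 / 2) ^ m = 1 := by rw [← mul_pow]; norm_num
            have h4 := mul_le_mul_of_nonneg_left h2 (show (0 : ℝ) ≤ 2 ^ m by positivity)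
            rw [h3] at h4
            have h5 : (num y : ℝ) * 2 ^ m / (den y + 1) = 2 ^ m * (num y / (den y + 1)) := by ring
            linarith
        _ = 2 ^ m * ((allStrs n).map P).sum + 2 ^ n := by
            rw [List.sum_map_add, List.sum_map_mul_left]
            simp [length_allStrs]
        -- The `2^n` approximation errors cost at most 1 each after scaling. The factor 2 between
        -- `2^m` and the code space `2^(m+1)` absorbs them.
        _ ≤ 2 ^ m * 1 + 2 ^ m := by
            have h1 := hP.2 n
            rw [← sum_allStrs_eq] at h1
            have h2 : (2 : ℝ) ^ n ≤ 2 ^ m := pow_le_pow_right₀ (by norm_num) (Nat.le_add_right _ _)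
            gcongr
        _ = 2 ^ (m + 1) := by ring
    exact_mod_cast hle
  rw [ModelKind.codeTable, htab, guardTable, if_pos hpf]
  -- The approximation may cost up to half of the weight `2^-L`, which accounts for one more
  -- codeword bit.
  refine exists_mem_arithTable (ℓ := L + 1) (a := num x) (b := den x) ?_ ?_ (by omega)
  · exact List.mem_map.2 ⟨x, mem_allStrs.2 rfl, rfl⟩
  · have h1 := (abs_le.1 (happrox x)).1
    have h2 : ((1 : ℝ) / 2) ^ m ≤ (1 / 2) ^ (L + 1) :=
      pow_le_pow_of_le_one (by norm_num) (by norm_num) (by omega)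
    have h3 : ((1 : ℝ) / 2) ^ (L + 1) ≤ (num x : ℝ) / (den x + 1) := by
      have : ((1 : ℝ) / 2) ^ (L + 1) = (1 / 2) ^ L / 2 := by ring
      linarith
    rw [le_div_iff₀ (by positivity), one_div, inv_pow, inv_mul_le_iff₀ (by positivity)] at h3
    have h4 : ((den x + 1 : ℕ) : ℝ) ≤ ((num x * 2 ^ (L + 1) : ℕ) : ℝ) := by
      push_cast
      linarith
    exact_mod_cast h4

/-! ### Functional statistics -/

/-- Functions, evaluated on all strings of length at most `n + b`. -/
def funKind (b : ℕ) : ModelKind where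
  labels n := strsUpTo (n + b)
  input n d := [strCode d, n]
  table _ res := res.filterMap fun r => r.2.head?.map (Prod.mk r.1)
  computable_labels :=
    (primrec_strsUpTo.comp (Primrec.nat_add.comp Primrec.id (Primrec.const b))).to_comp
  computable_input := (Primrec.list_cons.comp (primrec_strCode.comp Primrec.snd)
    (Primrec.list_cons.comp Primrec.fst (Primrec.const []))).to_comp
  computable_table := by
    refine (Primrec.listFilterMap Primrec.snd ?_).to_comp
    refine Primrec.option_map (Primrec.list_head?.comp (Primrec.snd.comp Primrec.snd)) ?_
    exact (Primrec.fst.comp (Primrec.snd.comp Primrec.fst)).pair Primrec.snd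
  labels_ne_nil n := List.ne_nil_of_mem (mem_strsUpTo.2 (Nat.zero_le _) : [] ∈ strsUpTo (n + b))

theorem mem_codeTable_funKind {b n : ℕ} {F : List Bool → Option (List Bool)} {x d : List Bool}
    (hF : IsPrefixFreeSet {d | (F d).isSome}) (hd : F d = some x) (hlen : d.length ≤ n + b) :
    (d, strCode x) ∈ (funKind b).codeTable n
      (fun d => (F d).elim [] fun y => [strCode y]) := by
  set tab := (funKind b).table n (((funKind b).labels n).map
    fun d => (d, (F d).elim [] fun y => [strCode y])) with htab
  have hmem : ∀ e, e ∈ tab ↔ e.1.length ≤ n + b ∧ ∃ y, F e.1 = some y ∧ e.2 = strCode y := by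
    rintro ⟨u, z⟩
    simp only [htab, funKind, List.mem_filterMap, List.mem_map, mem_strsUpTo]
    constructor
    · rintro ⟨-, ⟨v, hv, rfl⟩, h⟩
      obtain ⟨z', hz', heq⟩ := Option.map_eq_some_iff.1 h
      obtain ⟨rfl, rfl⟩ := Prod.ext_iff.1 heq
      refine ⟨hv, ?_⟩
      dsimp only at hz' ⊢
      cases hFv : F v with
      | none => simp [hFv] at hz'
      | some y => exact ⟨y, rfl, by simpa [hFv, eq_comm] using hz'⟩
    · rintro ⟨hv, y, hy, hz⟩
      exact ⟨_, ⟨u, hv, rfl⟩, by simp [hy, hz]⟩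
  have hpf : PrefixFreeTable tab := by
    intro e he e' he' hee
    obtain ⟨-, y, hy, hz⟩ := (hmem e).1 he
    obtain ⟨-, y', hy', hz'⟩ := (hmem e').1 he'
    have h1 : e.1 = e'.1 := hF e.1 (by simp [hy]) e'.1 (by simp [hy']) hee
    rw [h1, hy'] at hy
    obtain rfl := Option.some.inj hy
    exact Prod.ext h1 (hz.trans hz'.symm)
  rw [ModelKind.codeTable, ← htab, guardTable, if_pos hpf]
  exact (hmem _).2 ⟨hlen, x, hd, rfl⟩

/-! ### From models to the three kinds of statistics -/

namespace Interpreter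

variable {Φ : Interpreter}

theorem ComputesWithin.mono {n C C' : ℕ} (h : C ≤ C') {u v : List ℕ}
    (hu : Φ.ComputesWithin n C u v) : Φ.ComputesWithin n C' u v :=
  let ⟨p, hp, hout⟩ := hu
  ⟨p, hp.trans h, hout⟩

/-- The two claims about models of `x` follow from claims about their shortest programs. -/
theorem depth_bounds_of_isShortest {d C C' : ℕ} (hC : C ≤ C') {x : List Bool}
    {D : Set (List Bool)}
    (h : ∀ q, IsShortest q D → Φ.ComputesWithin x.length C [strCode q, Φ.mDepth d x]
        [strCode (Φ.omegaBits x.length (Φ.mDepth d x))] ∧ Φ.mDepth d x ≤ q.length + C) :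
    (∀ q, IsShortest q D → Φ.ComputesWithin x.length C' [strCode q, Φ.mDepth d x]
        [strCode (Φ.omegaBits x.length (Φ.mDepth d x))]) ∧
      (Φ.mDepth d x : ℕ∞) ≤
        minLength D + 2 * (Nat.clog 2 (Φ.mDepth d x) : ℕ∞) + C' := by
  refine ⟨fun q hq => (h q hq).1.mono hC, ?_⟩
  rcases D.eq_empty_or_nonempty with rfl | hne
  -- Without programs the complexity is `⊤`.
  · simp [minLength]
  · obtain ⟨q, hq⟩ := exists_isShortest hne
    rw [hq.minLength_eq]
    have := (h q hq).2
    exact_mod_cast (show Φ.mDepth d x ≤ q.length + 2 * Nat.clog 2 (Φ.mDepth d x) + C' by omega)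

theorem exists_depth_bounds_setStat (hpf : Φ.PrefixFree) (hopt : Φ.Optimal) (c : ℕ) :
    ∃ d₀ : ℕ, ∀ d : ℕ, d₀ ≤ d → ∃ C : ℕ, ∀ x S, Φ.IsSetStat c x S →
      ∀ q, IsShortest q (Φ.setPrograms x.length S) →
        Φ.ComputesWithin x.length C [strCode q, Φ.mDepth d x]
          [strCode (Φ.omegaBits x.length (Φ.mDepth d x))] ∧ Φ.mDepth d x ≤ q.length + C := by
  obtain ⟨d₀, hd₀⟩ := setKind.exists_depth_bounds hpf hopt (c + 2)
  refine ⟨d₀, fun d hd => (hd₀ d hd).imp fun C hC x S hS q hq => ?_⟩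
  obtain ⟨w, hout, hw⟩ := hq.1
  obtain ⟨v, hv, hlen⟩ := exists_mem_codeTable_setKind (n := x.length) hS.1 hw
  refine hC x q v (fun _ => w) (fun y _ => hout) hv ?_
  have h := hS.2.1
  rw [setK, hq.minLength_eq] at h
  calc ((q.length + v.length : ℕ) : ℕ∞)
      ≤ ((q.length + Nat.clog 2 S.card + 2 : ℕ) : ℕ∞) := by exact_mod_cast (by omega)
    _ = q.length + Nat.clog 2 S.card + 2 := by push_cast; rfl
    _ ≤ Φ.K x.length x + c + 2 := by gcongr
    _ = Φ.K x.length x + ((c + 2 : ℕ) : ℕ∞) := by push_cast; rw [add_assoc]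

/-- Sufficiency and `K(x) ≤ n + c₁` bound `-log P(x)` by `n + c₁ + c`, so evaluating `P` with
precision `n + O(1)` is enough to give `x` a codeword of nearly ideal length; its overhead of 3 bits
enters the slack. -/
theorem exists_depth_bounds_probStat (hpf : Φ.PrefixFree) (hopt : Φ.Optimal) (c : ℕ) :
    ∃ d₀ : ℕ, ∀ d : ℕ, d₀ ≤ d → ∃ C : ℕ, ∀ x P, Φ.IsProbStat c x P →
      ∀ q, IsShortest q (Φ.measurePrograms x.length P) →
        Φ.ComputesWithin x.length C [strCode q, Φ.mDepth d x]
          [strCode (Φ.omegaBits x.length (Φ.mDepth d x))] ∧ Φ.mDepth d x ≤ q.length + C := by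
  obtain ⟨c₁, hc₁⟩ := hopt.exists_K_le
  obtain ⟨d₀, hd₀⟩ := (probKind (c₁ + c + 2)).exists_depth_bounds hpf hopt (c + 3)
  refine ⟨d₀, fun d hd => (hd₀ d hd).imp fun C hC x P hP q hq => ?_⟩
  obtain ⟨hsemi, -, hpos, h, -⟩ := hP
  set L := ⌈-Real.logb 2 (P x)⌉₊ with hLdef
  rw [measureK, hq.minLength_eq] at h
  have hL : ((1 : ℝ) / 2) ^ L ≤ P x := by
    have h1 : -(L : ℝ) ≤ Real.logb 2 (P x) := by
      have := Nat.le_ceil (-Real.logb 2 (P x))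
      rw [← hLdef] at this
      linarith
    rw [Real.le_logb_iff_rpow_le (by norm_num) hpos, Real.rpow_neg (by norm_num),
      Real.rpow_natCast] at h1
    rwa [one_div, inv_pow]
  have hLb : q.length + L ≤ x.length + c₁ + c := by
    have : ((q.length + L : ℕ) : ℕ∞) ≤ ((x.length + c₁ + c : ℕ) : ℕ∞) := by
      calc ((q.length + L : ℕ) : ℕ∞) = q.length + L := by push_cast; rfl
        _ ≤ Φ.K x.length x + c := h
        _ ≤ ((x.length + c₁ : ℕ) : ℕ∞) + c := by gcongr; exact hc₁ x
        _ = ((x.length + c₁ + c : ℕ) : ℕ∞) := by push_cast; rfl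
    exact_mod_cast this
  choose num den hout happrox using fun y => hq.1 y (x.length + (c₁ + c + 2))
  obtain ⟨v, hv, hlen⟩ := exists_mem_codeTable_probKind hsemi hL (by omega) happrox
  refine hC x q v _ (fun y _ => hout y) hv ?_
  calc ((q.length + v.length : ℕ) : ℕ∞)
      ≤ ((q.length + L + 3 : ℕ) : ℕ∞) := by exact_mod_cast (by omega)
    _ = q.length + L + 3 := by push_cast; rfl
    _ ≤ Φ.K x.length x + c + 3 := by gcongr
    _ = Φ.K x.length x + ((c + 3 : ℕ) : ℕ∞) := by push_cast; rw [add_assoc]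

/-- The argument `v` with value `x` serves as the codeword without overhead. Its length is at most
`K(x) + c ≤ n + c₁ + c`, so evaluating the function up to that length is enough. -/
theorem exists_depth_bounds_funStat (hpf : Φ.PrefixFree) (hopt : Φ.Optimal) (c : ℕ) :
    ∃ d₀ : ℕ, ∀ d : ℕ, d₀ ≤ d → ∃ C : ℕ, ∀ x F, Φ.IsFunStat c x F →
      ∀ q, IsShortest q (Φ.funPrograms x.length F) →
        Φ.ComputesWithin x.length C [strCode q, Φ.mDepth d x]
          [strCode (Φ.omegaBits x.length (Φ.mDepth d x))] ∧ Φ.mDepth d x ≤ q.length + C := by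
  obtain ⟨c₁, hc₁⟩ := hopt.exists_K_le
  obtain ⟨d₀, hd₀⟩ := (funKind (c₁ + c)).exists_depth_bounds hpf hopt c
  refine ⟨d₀, fun d hd => (hd₀ d hd).imp fun C hC x F hF q hq => ?_⟩
  obtain ⟨hdom, -, v, hv, h, -⟩ := hF
  rw [funK, hq.minLength_eq, ← Nat.cast_add] at h
  have hlen : q.length + v.length ≤ x.length + (c₁ + c) := by
    have : ((q.length + v.length : ℕ) : ℕ∞) ≤ ((x.length + (c₁ + c) : ℕ) : ℕ∞) := by
      calc ((q.length + v.length : ℕ) : ℕ∞) ≤ Φ.K x.length x + c := h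
        _ ≤ ((x.length + c₁ : ℕ) : ℕ∞) + c := by gcongr; exact hc₁ x
        _ = ((x.length + (c₁ + c) : ℕ) : ℕ∞) := by push_cast; rw [add_assoc]
    exact_mod_cast this
  exact hC x q v _ (fun y _ => hq.1 y) (mem_codeTable_funKind hdom hv (by omega)) h

end Interpreter

/-- For an optimal prefix-free interpreter `Φ`, sufficiency constant `c`, minimality constant `c'`,
and every sufficiently large constant `d` in the definition of the m-depth. -/
theorem proposition4p3 (Φ : Interpreter) (hpf : Φ.PrefixFree) (hopt : Φ.Optimal) (c c' : ℕ) :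
    ∃ d₀ : ℕ, ∀ d : ℕ, d₀ ≤ d → ∃ C : ℕ, ∀ x : List Bool,
      (∀ S : Finset (List Bool), Φ.IsMinSetStat c c' x S →
        (∀ q, IsShortest q (Φ.setPrograms x.length S) →
          Φ.ComputesWithin x.length C [strCode q, Φ.mDepth d x]
            [strCode (Φ.omegaBits x.length (Φ.mDepth d x))]) ∧
        (Φ.mDepth d x : ℕ∞) ≤
          Φ.setK x.length S + 2 * (Nat.clog 2 (Φ.mDepth d x) : ℕ∞) + C) ∧
      (∀ P : List Bool → ℝ, Φ.IsMinProbStat c c' x P →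
        (∀ q, IsShortest q (Φ.measurePrograms x.length P) →
          Φ.ComputesWithin x.length C [strCode q, Φ.mDepth d x]
            [strCode (Φ.omegaBits x.length (Φ.mDepth d x))]) ∧
        (Φ.mDepth d x : ℕ∞) ≤
          Φ.measureK x.length P + 2 * (Nat.clog 2 (Φ.mDepth d x) : ℕ∞) + C) ∧
      (∀ F : List Bool → Option (List Bool), Φ.IsMinFunStat c c' x F →
        (∀ q, IsShortest q (Φ.funPrograms x.length F) →
          Φ.ComputesWithin x.length C [strCode q, Φ.mDepth d x]
            [strCode (Φ.omegaBits x.length (Φ.mDepth d x))]) ∧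
        (Φ.mDepth d x : ℕ∞) ≤
          Φ.funK x.length F + 2 * (Nat.clog 2 (Φ.mDepth d x) : ℕ∞) + C) := by
  obtain ⟨d₁, h₁⟩ := Interpreter.exists_depth_bounds_setStat hpf hopt c
  obtain ⟨d₂, h₂⟩ := Interpreter.exists_depth_bounds_probStat hpf hopt c
  obtain ⟨d₃, h₃⟩ := Interpreter.exists_depth_bounds_funStat hpf hopt c
  refine ⟨d₁ + d₂ + d₃, fun d hd => ?_⟩
  obtain ⟨C₁, h₁⟩ := h₁ d (by omega)
  obtain ⟨C₂, h₂⟩ := h₂ d (by omega)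
  obtain ⟨C₃, h₃⟩ := h₃ d (by omega)
  refine ⟨C₁ + C₂ + C₃, fun x => ⟨fun S hS => ?_, fun P hP => ?_, fun F hF => ?_⟩⟩
  · exact Interpreter.depth_bounds_of_isShortest (by omega) (h₁ x S hS.1)
  · exact Interpreter.depth_bounds_of_isShortest (by omega) (h₂ x P hP.1)
  · exact Interpreter.depth_bounds_of_isShortest (by omega) (h₃ x F hF.1)
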